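/- Let $(E,d)$ be a nonempty complete separable metric space with its Borel $\sigma$-algebra, let $(X_n)_{n\ge 0}$ be a homogeneous Markov chain on $E$ with transition kernel $P(x,A)$ and $n$-step transition kernels $P^n(x,A)$, and write $Pf(x)=\int_E f(y)\,P(x,dy)$. For probability measures $\mu,\nu$ on $E$ let $$W_d(\mu,\nu)=\inf_{\lambda}\int_{E\times E} d(x,y)\,\lambda(dx,dy),$$ the infimum being over all probability measures $\lambda$ on $E\times E$ with marginals $\mu$ and $\nu$. Suppose that there are a measurable function $V:E\to[0,\infty)$, a concave function $\varphi:[0,\infty)\to[0,\infty)$ with $\varphi(0)=0$ that is continuous on $[0,\infty)$, differentiable on $(0,\infty)$ and strictly increasing to infinity, and a constant $K\ge 0$ such that: 1. $PV(x)\le V(x)-\varphi(V(x))+K$ for all $x\in E$; 2. $W_d(P(x,\cdot),P(y,\cdot))\le d(x,y)\le 1$ for all $x,y\in E$; 3. for some $R>\varphi^{-1}(2K)$ there exists $\rho>0$ such that $W_d(P(x,\cdot),P(y,\cdot))\le(1-\rho)\,d(x,y)$ for all $x,y\in E$ with $V(x)+V(y)\le R$. Then the chain has a unique invariant probability measure $\pi$,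 and $$\int_E\varphi(V(u))\,\pi(du)\le K.$$ Moreover, with $H_\varphi(x)=\int_1^x \frac{du}{\varphi(u)}$ for $x\ge 1$ and $H_\varphi^{-1}:[0,\infty)\to[1,\infty)$ its inverse, for every $\varepsilon>0$ there exist constants $C_1,C_2>0$ such that for all $x\in E$ and all integers $n\ge 0$ $$W_d(P^n(x,\cdot),\pi)\le \frac{C_1\,(1+V(x))}{\varphi\bigl(H_\varphi^{-1}(C_2 n)\bigr)^{1-\varepsilon}}.$$ -/

import Mathlib

open MeasureTheory ProbabilityTheory Set Filter
open scoped ENNReal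

namespace SubgeomErgodic

/-- `γ` is a coupling of `μ` and `ν`: a measure on the product with marginals `μ` and `ν`
(it is a probability measure as soon as `μ` is one). -/
def IsCoupling {E : Type*} [MeasurableSpace E] (γ : Measure (E × E)) (μ ν : Measure E) : Prop :=
  γ.map Prod.fst = μ ∧ γ.map Prod.snd = ν

/-- The Wasserstein semidistance
`W_d(μ, ν) = inf { ∫ d(x, y) γ(dx, dy) : γ a coupling of μ and ν }`, with values in `[0, ∞]`,
for a nonnegative function `d` on `E × E`. -/
noncomputable def W {E : Type*} [MeasurableSpace E] (d : E → E → ℝ) (μ ν : Measure E) : ℝ≥0∞ :=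
  ⨅ (γ : Measure (E × E)) (_ : IsCoupling γ μ ν), ∫⁻ p, ENNReal.ofReal (d p.1 p.2) ∂γ

/-- A set `L` of pairs of points is `d`-small for the transition kernel `P` if for some `ρ > 0`,
`W_d(P(x,·), P(y,·)) ≤ (1 - ρ) d(x, y)` for all `(x, y) ∈ L`.
A set `A` of points is `d`-small when `A ×ˢ A` is. -/
def IsDSmall {E : Type*} [MeasurableSpace E] (d : E → E → ℝ) (P : Kernel E E)
    (L : Set (E × E)) : Prop :=
  ∃ ρ : ℝ, 0 < ρ ∧ ∀ p ∈ L, W d (P p.1) (P p.2) ≤ ENNReal.ofReal ((1 - ρ) * d p.1 p.2)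

/-- `H_f(x) = ∫_1^x du / f(u)`, used for `x ≥ 1`. -/
noncomputable def H (f : ℝ → ℝ) (x : ℝ) : ℝ := ∫ u in (1 : ℝ)..x, 1 / f u

/-- The inverse of the function `H_f : [1, ∞) → [0, ∞)`. -/
noncomputable def HInv (f : ℝ → ℝ) : ℝ → ℝ := Function.invFunOn (H f) (Ici 1)

end SubgeomErgodic

/-!
# Subgeometric convergence of Markov chains in the Wasserstein distance

The rate comes from a one-step contraction for a cost that interpolates between the distance and
the Lyapunov function. Let `G_s` be the flow of `u' = φ u` at time `s`, so that
`G_s u = HInv φ (H φ u + s)`, and for `0 < e < 1` put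
`ℓ_s (x, y) = d (x, y) ^ e * G_s (M + V x + V y) ^ (1 - e)`.
For any coupling of `P x` and `P y`, Hölder's inequality bounds the expectation of `ℓ_{s+c}` by the
two factors separately, and Jensen's inequality applies to the second one because `G_s` is concave
(`IsRate.concaveOn_flow`). If `V x + V y > R`, subadditivity of `φ` turns the drift condition into
`E U' ≤ U - c φ U` for `U = M + V x + V y`, and this decrease compensates the time `c` of the flow
(`IsRate.flow_add_le`). If `V x + V y ≤ R`, the second factor grows at most by a constant that is as
close to `1` as desired for `M` large (`IsRate.flow_le_mul_flow`), so that the contraction of `d`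
wins. Hence `ℓ` does not increase along the coupled chain (`exists_flowCost_step`), and as
`G_{cn} ≥ HInv φ (c n)` the expected distance after `n` steps is at most
`(U / HInv φ (c n)) ^ (1 - e)`.

To run this argument one needs couplings of `P x` and `P y` that depend measurably on `(x, y)`. They
are obtained up to a factor `1 + δ` without any compactness argument (`exists_kernel_isCoupling`):
countably many couplings with explicit piecewise constant density are nearly optimal for all pairs
of laws, and one takes the first that is good enough. The factor `(1 + δ) ^ n` disappears as
`δ → 0`.

An invariant law integrates only `φ ∘ V`, not `V`. Therefore the bound above is truncated at `1` and
`min 1 (v / A) ≤ φ v / φ A` is used (`IsRate.min_one_rpow_le`), which leads to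
`exists_W_pow_bind_le`: the distance between the laws after `n` steps from `x` and from an initial
law `ν` is controlled by `∫ φ ∘ V dν`. The drift condition bounds this integral by `K` for an
invariant law (`lintegral_le_of_invariant`), which gives uniqueness and the rate, and by `2 K + 1`
for sufficiently many of the laws `P ^ m x` (`exists_lintegral_add_le`), which makes `P ^ n x` a
Cauchy sequence. Completeness of the Wasserstein distance (`exists_tendsto_W`) follows by realising
consecutive couplings on one space with the Ionescu-Tulcea theorem; the limit is invariant because
the kernel contracts the distance.
-/

namespace SubgeomErgodic

/-! ### Couplings and the Wasserstein distance -/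

section Coupling

variable {E : Type*} [MeasurableSpace E] {μ ν ξ : Measure E} {γ γ' : Measure (E × E)}

lemma IsCoupling.isProbabilityMeasure [IsProbabilityMeasure μ] (h : IsCoupling γ μ ν) :
    IsProbabilityMeasure γ := by
  constructor
  have : γ.map Prod.fst univ = 1 := by rw [h.1]; simp
  rwa [Measure.map_apply measurable_fst MeasurableSet.univ] at this

lemma IsCoupling.swap (h : IsCoupling γ μ ν) : IsCoupling (γ.map Prod.swap) ν μ := by
  constructor
  · rw [Measure.map_map measurable_fst measurable_swap]; exact h.2
  · rw [Measure.map_map measurable_snd measurable_swap]; exact h.1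

lemma isCoupling_prod [IsProbabilityMeasure μ] [IsProbabilityMeasure ν] :
    IsCoupling (μ.prod ν) μ ν := by
  constructor <;> simp

lemma isCoupling_diag : IsCoupling (μ.map (fun x => (x, x))) μ μ := by
  have : Measurable (fun x : E => (x, x)) := by fun_prop
  constructor
  · rw [Measure.map_map measurable_fst this]; exact Measure.map_id
  · rw [Measure.map_map measurable_snd this]; exact Measure.map_id

lemma IsCoupling.lintegral_fst (h : IsCoupling γ μ ν) {f : E → ℝ≥0∞} (hf : Measurable f) :
    ∫⁻ p, f p.1 ∂γ = ∫⁻ x, f x ∂μ := by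
  rw [← h.1, lintegral_map hf measurable_fst]

lemma IsCoupling.lintegral_snd (h : IsCoupling γ μ ν) {f : E → ℝ≥0∞} (hf : Measurable f) :
    ∫⁻ p, f p.2 ∂γ = ∫⁻ x, f x ∂ν := by
  rw [← h.2, lintegral_map hf measurable_snd]

/-- Pushing a coupling forward by a kernel of couplings gives a coupling of the images. -/
lemma IsCoupling.bind (h : IsCoupling γ μ ν) {κ η : Kernel E E} {Q : Kernel (E × E) (E × E)}
    (hQ : ∀ p, IsCoupling (Q p) (κ p.1) (η p.2)) :
    IsCoupling (γ.bind Q) (μ.bind κ) (ν.bind η) := by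
  constructor
  · ext s hs
    rw [Measure.map_apply measurable_fst hs,
      Measure.bind_apply (measurable_fst hs) Q.measurable.aemeasurable,
      Measure.bind_apply hs κ.measurable.aemeasurable,
      ← h.lintegral_fst (κ.measurable_coe hs)]
    refine lintegral_congr fun p => ?_
    rw [← (hQ p).1, Measure.map_apply measurable_fst hs]
  · ext s hs
    rw [Measure.map_apply measurable_snd hs,
      Measure.bind_apply (measurable_snd hs) Q.measurable.aemeasurable,
      Measure.bind_apply hs η.measurable.aemeasurable,
      ← h.lintegral_snd (η.measurable_coe hs)]
    refine lintegral_congr fun p => ?_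
    rw [← (hQ p).2, Measure.map_apply measurable_snd hs]

/-- Gluing lemma: two couplings with a common marginal are realised by three random variables,
the common one being the first coordinate of the triple. -/
lemma IsCoupling.exists_glue [StandardBorelSpace E] [Nonempty E] [IsProbabilityMeasure ν]
    (h : IsCoupling γ μ ν) (h' : IsCoupling γ' ν ξ) :
    ∃ m : Measure (E × E × E), m.map (fun t => (t.2.1, t.1)) = γ ∧
      m.map (fun t => (t.1, t.2.2)) = γ' := by
  have hs := h.swap
  have := hs.isProbabilityMeasure
  have := h'.isProbabilityMeasure
  set σ := γ.map Prod.swap with hσ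
  refine ⟨ν ⊗ₘ (σ.condKernel ×ₖ γ'.condKernel), ?_, ?_⟩
  · have h1 : (ν ⊗ₘ (σ.condKernel ×ₖ γ'.condKernel)).map (Prod.map id Prod.fst) = σ := by
      rw [← Measure.compProd_map measurable_fst, ← Kernel.fst_eq, Kernel.fst_prod]
      conv_lhs => rw [← hs.1]
      exact σ.disintegrate σ.condKernel
    have h2 : γ = σ.map Prod.swap := by
      rw [hσ, Measure.map_map measurable_swap measurable_swap]
      simp
    refine Eq.trans ?_ ((congrArg (Measure.map Prod.swap) h1).trans h2.symm)
    rw [Measure.map_map measurable_swap (by fun_prop)]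
    rfl
  · have h1 : (ν ⊗ₘ (σ.condKernel ×ₖ γ'.condKernel)).map (Prod.map id Prod.snd) = γ' := by
      rw [← Measure.compProd_map measurable_snd, ← Kernel.snd_eq, Kernel.snd_prod]
      conv_lhs => rw [← h'.1]
      exact γ'.disintegrate γ'.condKernel
    exact h1

end Coupling

section Wasserstein

variable {E : Type*} [MetricSpace E] [MeasurableSpace E] {μ ν ξ : Measure E}
  {γ : Measure (E × E)}

lemma W_dist_eq : W dist μ ν =
    ⨅ (γ : Measure (E × E)) (_ : IsCoupling γ μ ν), ∫⁻ p, edist p.1 p.2 ∂γ := by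
  simp only [W, edist_dist]

lemma IsCoupling.W_le (h : IsCoupling γ μ ν) : W dist μ ν ≤ ∫⁻ p, edist p.1 p.2 ∂γ := by
  rw [W_dist_eq]
  exact iInf₂_le γ h

lemma exists_coupling_of_W_lt {c : ℝ≥0∞} (h : W dist μ ν < c) :
    ∃ γ, IsCoupling γ μ ν ∧ ∫⁻ p, edist p.1 p.2 ∂γ < c := by
  rw [W_dist_eq] at h
  simpa only [iInf_lt_iff, exists_prop] using h

lemma W_le_one [IsProbabilityMeasure μ] [IsProbabilityMeasure ν]
    (hbdd : ∀ x y : E, dist x y ≤ 1) : W dist μ ν ≤ 1 := by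
  refine isCoupling_prod.W_le.trans ?_
  calc ∫⁻ p, edist p.1 p.2 ∂(μ.prod ν) ≤ ∫⁻ _, 1 ∂(μ.prod ν) := by
        refine lintegral_mono fun p => ?_
        rw [edist_dist]
        exact ENNReal.ofReal_le_one.2 (hbdd _ _)
    _ = 1 := by simp

variable [BorelSpace E] [SecondCountableTopology E]

lemma W_comm : W dist μ ν = W dist ν μ := by
  have key : ∀ μ ν : Measure E, W dist μ ν ≤ W dist ν μ := by
    intro μ ν
    refine le_of_forall_gt fun c hc => ?_
    obtain ⟨γ, hγ, hlt⟩ := exists_coupling_of_W_lt hc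
    refine hγ.swap.W_le.trans_lt ?_
    rw [lintegral_map (by fun_prop) measurable_swap]
    simpa only [Prod.fst_swap, Prod.snd_swap, edist_comm] using hlt
  exact le_antisymm (key _ _) (key _ _)

lemma W_triangle [CompleteSpace E] [Nonempty E] [IsProbabilityMeasure ν] :
    W dist μ ξ ≤ W dist μ ν + W dist ν ξ := by
  rw [W_dist_eq (μ := μ) (ν := ν), W_dist_eq (μ := ν) (ν := ξ)]
  refine ENNReal.le_iInf₂_add_iInf₂ fun γ h γ' h' => ?_
  obtain ⟨m, hm, hm'⟩ := h.exists_glue h'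
  have hc : IsCoupling (m.map Prod.snd) μ ξ := by
    constructor
    · rw [← h.1, ← hm, Measure.map_map (by fun_prop) (by fun_prop),
        Measure.map_map (by fun_prop) (by fun_prop)]
      rfl
    · rw [← h'.2, ← hm', Measure.map_map (by fun_prop) (by fun_prop),
        Measure.map_map (by fun_prop) (by fun_prop)]
      rfl
  refine hc.W_le.trans ?_
  rw [← hm, ← hm', lintegral_map (by fun_prop) (by fun_prop),
    lintegral_map (by fun_prop) (by fun_prop), lintegral_map (by fun_prop) (by fun_prop),
    ← lintegral_add_left (by fun_prop)]
  exact lintegral_mono fun t => edist_triangle _ _ _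

lemma measure_le_of_W_eq_zero [IsFiniteMeasure ν] (h : W dist μ ν = 0) {F : Set E}
    (hF : IsClosed F) : μ F ≤ ν F := by
  have hthick : ∀ δ : ℝ, 0 < δ → μ F ≤ ν (Metric.cthickening δ F) := by
    intro δ hδ
    have hδ' : ENNReal.ofReal δ ≠ 0 := by simpa using hδ
    refine ENNReal.le_of_forall_pos_le_add fun ε hε _ => ?_
    obtain ⟨γ, hγ, hlt⟩ := exists_coupling_of_W_lt (μ := μ) (ν := ν)
      (c := ε * ENNReal.ofReal δ) (by rw [h]; exact ENNReal.mul_pos (by simpa using hε.ne') hδ')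
    have hcl : MeasurableSet (Metric.cthickening δ F) :=
      Metric.isClosed_cthickening.measurableSet
    have hsub : Prod.fst ⁻¹' F ⊆ Prod.snd ⁻¹' Metric.cthickening δ F ∪
        {p : E × E | ENNReal.ofReal δ ≤ edist p.1 p.2} := by
      rintro ⟨x, y⟩ hx
      by_cases hxy : ENNReal.ofReal δ ≤ edist x y
      · exact Or.inr hxy
      · refine Or.inl ?_
        have hlt' := not_le.1 hxy
        rw [edist_dist, ENNReal.ofReal_lt_ofReal_iff hδ] at hlt'
        exact Metric.mem_cthickening_of_dist_le y x δ F hx (by rw [dist_comm]; exact hlt'.le)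
    calc μ F = γ (Prod.fst ⁻¹' F) := by
          rw [← hγ.1, Measure.map_apply measurable_fst hF.measurableSet]
      _ ≤ γ (Prod.snd ⁻¹' Metric.cthickening δ F) +
          γ {p : E × E | ENNReal.ofReal δ ≤ edist p.1 p.2} :=
          (measure_mono hsub).trans (measure_union_le _ _)
      _ ≤ ν (Metric.cthickening δ F) + ε := by
          gcongr
          · rw [← hγ.2, Measure.map_apply measurable_snd hcl]
          · refine (meas_ge_le_lintegral_div (by fun_prop) hδ' ENNReal.ofReal_ne_top).trans ?_
            exact ENNReal.div_le_of_le_mul hlt.le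
  have hlim := tendsto_measure_cthickening_of_isClosed (μ := ν) (s := F)
    ⟨1, one_pos, measure_ne_top _ _⟩ hF
  refine ge_of_tendsto (hlim.mono_left (nhdsWithin_le_nhds (s := Ioi 0))) ?_
  filter_upwards [self_mem_nhdsWithin] with δ hδ using hthick δ hδ

lemma eq_of_W_eq_zero [IsProbabilityMeasure μ] [IsProbabilityMeasure ν]
    (h : W dist μ ν = 0) : μ = ν := by
  refine ext_of_generate_finite _ ?_ isPiSystem_isClosed (fun F hF => ?_) (by simp)
  · rw [BorelSpace.measurable_eq (α := E), borel_eq_generateFrom_isClosed]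
  · exact le_antisymm (measure_le_of_W_eq_zero h hF)
      (measure_le_of_W_eq_zero (by rwa [W_comm]) hF)

end Wasserstein

/-! ### Couplings with piecewise constant density -/

section Density

/-- Given a matrix `a` of nonnegative weights whose row sums are bounded by `p` and whose column
sums are bounded by `q`, the density with respect to `p ⊗ q` of the coupling of `p` and `q` that
moves the mass `a i j` from `i` to `j` and couples the remaining mass independently. -/
noncomputable def couplingDensity (a : ℕ → ℕ → ℝ≥0∞) (p q : ℕ → ℝ≥0∞) (i j : ℕ) : ℝ≥0∞ :=
  a i j / (p i * q j) +
    (1 - (∑' l, a i l) / p i) * (1 - (∑' k, a k j) / q j) / (1 - ∑' k, ∑' l, a k l)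

variable {a : ℕ → ℕ → ℝ≥0∞} {p q : ℕ → ℝ≥0∞}

lemma couplingDensity_swap (i j : ℕ) :
    couplingDensity a p q i j = couplingDensity (fun k l => a l k) q p j i := by
  simp only [couplingDensity]
  rw [ENNReal.tsum_comm, mul_comm (p i), mul_comm (1 - (∑' l, a i l) / p i)]

lemma one_sub_div_mul_self {r s : ℝ≥0∞} (hs : s ≠ ∞) (hr : r ≤ s) :
    (1 - r / s) * s = s - r := by
  rw [ENNReal.sub_mul (fun _ _ => hs), one_mul,
    ENNReal.div_mul_cancel' (fun h => le_antisymm (h ▸ hr) zero_le) (fun h => absurd h hs)]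

lemma ne_top_of_tsum_eq_one (hq1 : ∑' j, q j = 1) (j : ℕ) : q j ≠ ∞ :=
  ne_top_of_le_ne_top (hq1 ▸ ENNReal.one_ne_top) (ENNReal.le_tsum j)

lemma tsum_sub_col (hq1 : ∑' j, q j = 1) (hcol : ∀ j, ∑' k, a k j ≤ q j)
    (hS : ∑' k, ∑' l, a k l < 1) :
    ∑' j, (q j - ∑' k, a k j) = 1 - ∑' k, ∑' l, a k l := by
  rw [ENNReal.tsum_sub _ hcol, hq1, ENNReal.tsum_comm]
  rw [ENNReal.tsum_comm]
  exact hS.ne_top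

lemma tsum_couplingDensity_mul (hq1 : ∑' j, q j = 1)
    (hrow : ∀ i, ∑' l, a i l ≤ p i) (hcol : ∀ j, ∑' k, a k j ≤ q j)
    (hS : ∑' k, ∑' l, a k l < 1) {i : ℕ} (hi : p i ≠ 0) (hi' : p i ≠ ∞) :
    ∑' j, couplingDensity a p q i j * q j = 1 := by
  have hqt := ne_top_of_tsum_eq_one hq1
  have hS0 : 1 - ∑' k, ∑' l, a k l ≠ 0 := (tsub_pos_of_lt hS).ne'
  have hSt : 1 - ∑' k, ∑' l, a k l ≠ ∞ := ENNReal.sub_ne_top ENNReal.one_ne_top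
  have h1 : ∀ j, couplingDensity a p q i j * q j = (p i)⁻¹ * a i j +
      (1 - (∑' l, a i l) / p i) * (1 - ∑' k, ∑' l, a k l)⁻¹ * (q j - ∑' k, a k j) := by
    intro j
    rw [couplingDensity, add_mul, ← one_sub_div_mul_self (hqt j) (hcol j)]
    congr 1
    · rcases eq_or_ne (q j) 0 with h0 | h0
      · have : a i j = 0 := by
          have := (ENNReal.le_tsum (f := fun k => a k j) i).trans (hcol j)
          simpa [h0] using this
        simp [this]
      · rw [div_eq_mul_inv, ENNReal.mul_inv (Or.inl hi) (Or.inl hi'), mul_assoc, mul_assoc,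
          ENNReal.inv_mul_cancel h0 (hqt j), mul_one, mul_comm]
    · rw [div_eq_mul_inv]; ring
  simp_rw [h1]
  rw [ENNReal.tsum_add, ENNReal.tsum_mul_left, ENNReal.tsum_mul_left, tsum_sub_col hq1 hcol hS,
    mul_assoc, ENNReal.inv_mul_cancel hS0 hSt, mul_one, mul_comm, ← div_eq_mul_inv]
  exact add_tsub_cancel_of_le (ENNReal.div_le_of_le_mul (by simpa using hrow i))

lemma tsum_mul_couplingDensity_mul_le (hp1 : ∑' i, p i = 1) (hq1 : ∑' j, q j = 1)
    (hrow : ∀ i, ∑' l, a i l ≤ p i) (hcol : ∀ j, ∑' k, a k j ≤ q j)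
    (hS : ∑' k, ∑' l, a k l < 1) {c : ℕ → ℕ → ℝ≥0∞} (hc : ∀ i j, c i j ≤ 1) :
    ∑' i, (∑' j, couplingDensity a p q i j * c i j * q j) * p i ≤
      ∑' i, ∑' j, a i j * c i j + (1 - ∑' k, ∑' l, a k l) := by
  have hpt := ne_top_of_tsum_eq_one hp1
  have hqt := ne_top_of_tsum_eq_one hq1
  set S := ∑' k, ∑' l, a k l with hSdef
  have hS0 : 1 - S ≠ 0 := (tsub_pos_of_lt hS).ne'
  have hSt : 1 - S ≠ ∞ := ENNReal.sub_ne_top ENNReal.one_ne_top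
  have h1 : ∀ i j, couplingDensity a p q i j * c i j * q j * p i ≤ a i j * c i j +
      (p i - ∑' l, a i l) * (1 - S)⁻¹ * (q j - ∑' k, a k j) := by
    intro i j
    have e : couplingDensity a p q i j * c i j * q j * p i =
        a i j / (p i * q j) * (p i * q j) * c i j +
        ((1 - (∑' l, a i l) / p i) * p i) * (1 - S)⁻¹ * ((1 - (∑' k, a k j) / q j) * q j)
          * c i j := by
      rw [couplingDensity, div_eq_mul_inv _ (1 - ∑' k, ∑' l, a k l), ← hSdef]; ring
    rw [e, one_sub_div_mul_self (hqt j) (hcol j), one_sub_div_mul_self (hpt i) (hrow i)]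
    refine add_le_add ?_ (mul_le_of_le_one_right' (hc i j))
    gcongr
    rw [div_eq_mul_inv, mul_assoc]
    exact mul_le_of_le_one_right' (ENNReal.inv_mul_le_one _)
  have hp' : ∑' i, (p i - ∑' l, a i l) = 1 - S := by
    have := tsum_sub_col (a := fun k l => a l k) hp1 hrow (by rwa [ENNReal.tsum_comm])
    rw [this, ENNReal.tsum_comm]
  calc _ = ∑' i, ∑' j, couplingDensity a p q i j * c i j * q j * p i := by
        simp_rw [ENNReal.tsum_mul_right]
    _ ≤ ∑' i, ∑' j, (a i j * c i j +
          (p i - ∑' l, a i l) * (1 - S)⁻¹ * (q j - ∑' k, a k j)) :=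
        ENNReal.tsum_le_tsum fun i => ENNReal.tsum_le_tsum fun j => h1 i j
    _ = _ := by
        simp_rw [ENNReal.tsum_add, ENNReal.tsum_mul_left, ENNReal.tsum_mul_right]
        rw [tsum_sub_col hq1 hcol hS, hp', ← hSdef, mul_assoc, ENNReal.inv_mul_cancel hS0 hSt,
          mul_one]

lemma lintegral_comp_nat {E : Type*} [MeasurableSpace E] {μ : Measure E} {t : E → ℕ}
    (ht : Measurable t) (F : ℕ → ℝ≥0∞) :
    ∫⁻ x, F (t x) ∂μ = ∑' i, F i * μ (t ⁻¹' {i}) := by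
  rw [← lintegral_map (measurable_of_countable F) ht, lintegral_countable']
  simp_rw [Measure.map_apply ht (measurableSet_singleton _)]

lemma tsum_measure_preimage_nat {E : Type*} [MeasurableSpace E] {μ : Measure E}
    [IsProbabilityMeasure μ] {t : E → ℕ} (ht : Measurable t) : ∑' i, μ (t ⁻¹' {i}) = 1 := by
  simpa using (lintegral_comp_nat (μ := μ) ht (fun _ => 1)).symm

variable {E : Type*} [MeasurableSpace E] {μ ν : Measure E} [IsProbabilityMeasure μ]
  [IsProbabilityMeasure ν] {t : E → ℕ}

lemma lintegral_couplingDensity (ht : Measurable t) (hp : ∀ i, p i = μ (t ⁻¹' {i}))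
    (hq : ∀ i, q i = ν (t ⁻¹' {i}))
    (hrow : ∀ i, ∑' l, a i l ≤ p i) (hcol : ∀ j, ∑' k, a k j ≤ q j)
    (hS : ∑' k, ∑' l, a k l < 1) :
    ∀ᵐ x ∂μ, ∫⁻ y, couplingDensity a p q (t x) (t y) ∂ν = 1 := by
  have hnull : ∀ᵐ x ∂μ, ∀ i, p i = 0 → t x ≠ i := by
    refine ae_all_iff.2 fun i => ?_
    by_cases h : p i = 0
    · have : μ (t ⁻¹' {i}) = 0 := by rw [← hp, h]
      filter_upwards [measure_eq_zero_iff_ae_notMem.1 this] with x hx _ using hx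
    · exact Eventually.of_forall fun x h' => absurd h' h
  filter_upwards [hnull] with x hx
  rw [lintegral_comp_nat ht (fun j => couplingDensity a p q (t x) j)]
  simp_rw [← hq]
  refine tsum_couplingDensity_mul ?_ hrow hcol hS (fun h => hx _ h rfl) ?_
  · simp_rw [hq]; exact tsum_measure_preimage_nat ht
  · rw [hp]; exact measure_ne_top _ _

lemma isCoupling_withDensity (ht : Measurable t) (hp : ∀ i, p i = μ (t ⁻¹' {i}))
    (hq : ∀ i, q i = ν (t ⁻¹' {i}))
    (hrow : ∀ i, ∑' l, a i l ≤ p i) (hcol : ∀ j, ∑' k, a k j ≤ q j)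
    (hS : ∑' k, ∑' l, a k l < 1) :
    IsCoupling ((μ.prod ν).withDensity fun z => couplingDensity a p q (t z.1) (t z.2)) μ ν := by
  have hm : Measurable fun z : E × E => couplingDensity a p q (t z.1) (t z.2) :=
    (measurable_of_countable (fun k : ℕ × ℕ => couplingDensity a p q k.1 k.2)).comp
      ((ht.comp measurable_fst).prodMk (ht.comp measurable_snd))
  constructor
  · ext s hs
    rw [Measure.map_apply measurable_fst hs, withDensity_apply _ (measurable_fst hs),
      ← lintegral_indicator (measurable_fst hs),
      lintegral_prod _ (hm.indicator (measurable_fst hs)).aemeasurable]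
    calc _ = ∫⁻ x, s.indicator 1 x ∂μ := by
          refine lintegral_congr_ae ?_
          filter_upwards [lintegral_couplingDensity ht hp hq hrow hcol hS] with x hx
          by_cases hxs : x ∈ s
          · simp [indicator, hxs, hx]
          · simp [indicator, hxs]
      _ = μ s := lintegral_indicator_one hs
  · ext s hs
    rw [Measure.map_apply measurable_snd hs, withDensity_apply _ (measurable_snd hs),
      ← lintegral_indicator (measurable_snd hs),
      lintegral_prod_symm _ (hm.indicator (measurable_snd hs)).aemeasurable]
    calc _ = ∫⁻ x, s.indicator 1 x ∂ν := by
          refine lintegral_congr_ae ?_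
          filter_upwards [lintegral_couplingDensity (a := fun k l => a l k) ht hq hp hcol hrow
            (by rwa [ENNReal.tsum_comm])] with y hy
          simp_rw [← couplingDensity_swap] at hy
          by_cases hys : y ∈ s
          · simp [indicator, hys, hy]
          · simp [indicator, hys]
      _ = ν s := lintegral_indicator_one hs

lemma lintegral_edist_withDensity_le {E : Type*} [MetricSpace E] [MeasurableSpace E] [BorelSpace E]
    [SecondCountableTopology E] {μ ν : Measure E} [IsProbabilityMeasure μ]
    [IsProbabilityMeasure ν] {t : E → ℕ} (ht : Measurable t) (hp : ∀ i, p i = μ (t ⁻¹' {i}))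
    (hq : ∀ i, q i = ν (t ⁻¹' {i}))
    (hrow : ∀ i, ∑' l, a i l ≤ p i) (hcol : ∀ j, ∑' k, a k j ≤ q j)
    (hS : ∑' k, ∑' l, a k l < 1) {c : ℕ → ℕ → ℝ≥0∞} (hc : ∀ i j, c i j ≤ 1)
    (hdc : ∀ x y, edist x y ≤ c (t x) (t y)) :
    ∫⁻ z, edist z.1 z.2
        ∂((μ.prod ν).withDensity fun z => couplingDensity a p q (t z.1) (t z.2)) ≤
      ∑' i, ∑' j, a i j * c i j + (1 - ∑' k, ∑' l, a k l) := by
  have hm : ∀ F : ℕ → ℕ → ℝ≥0∞, Measurable fun z : E × E => F (t z.1) (t z.2) := fun F =>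
    (measurable_of_countable (fun k : ℕ × ℕ => F k.1 k.2)).comp
      ((ht.comp measurable_fst).prodMk (ht.comp measurable_snd))
  rw [lintegral_withDensity_eq_lintegral_mul _ (hm _) (by fun_prop)]
  calc _ ≤ ∫⁻ z, couplingDensity a p q (t z.1) (t z.2) * c (t z.1) (t z.2) ∂(μ.prod ν) :=
        lintegral_mono fun z => mul_le_mul_right (hdc _ _) _
    _ = ∑' i, (∑' j, couplingDensity a p q i j * c i j * q j) * p i := by
        rw [lintegral_prod _ (hm (fun i j => couplingDensity a p q i j * c i j)).aemeasurable]
        simp_rw [hp, hq]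
        rw [← lintegral_comp_nat ht]
        refine lintegral_congr fun x => ?_
        rw [← lintegral_comp_nat ht (fun j => couplingDensity a _ _ (t x) j * c (t x) j)]
    _ ≤ _ := by
        refine tsum_mul_couplingDensity_mul_le ?_ ?_ hrow hcol hS hc
        · simp_rw [hp]; exact tsum_measure_preimage_nat ht
        · simp_rw [hq]; exact tsum_measure_preimage_nat ht

end Density

/-! ### Measurable selection of nearly optimal couplings -/

section Selection

lemma exists_rat_le_ennreal {x δ : ℝ≥0∞} (hx : x ≠ ∞) (hδ : δ ≠ 0) :
    ∃ r : ℚ, ENNReal.ofReal r ≤ x ∧ x ≤ ENNReal.ofReal r + δ := by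
  rcases eq_or_ne x 0 with rfl | h0
  · exact ⟨0, by simp, by simp⟩
  · obtain ⟨r, -, h1, h2⟩ := ENNReal.lt_iff_exists_rat_btwn.1 (ENNReal.sub_lt_self hx h0 hδ)
    exact ⟨r, h2.le, tsub_le_iff_right.1 h1.le⟩

/-- A summable family of nonnegative weights is approximated from below by finitely supported
rational ones. -/
lemma exists_finsupp_rat_le {g : ℕ × ℕ → ℝ≥0∞} (hg : ∑' z, g z ≠ ∞) {δ : ℝ≥0∞} (hδ : δ ≠ 0) :
    ∃ A : ℕ × ℕ →₀ ℚ, (∀ z, ENNReal.ofReal (A z) ≤ g z) ∧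
      ∑' z, g z ≤ ∑' z, ENNReal.ofReal (A z) + δ := by
  classical
  have hδ2 : δ / 2 ≠ 0 := (ENNReal.half_pos hδ).ne'
  obtain ⟨F, hF⟩ : ∃ F : Finset (ℕ × ℕ), ∑' z, g z ≤ ∑ z ∈ F, g z + δ / 2 := by
    rcases eq_or_ne (∑' z, g z) 0 with h0 | h0
    · exact ⟨∅, by simp [h0]⟩
    · have hlt := ENNReal.sub_lt_self hg h0 hδ2
      conv_rhs at hlt => rw [ENNReal.tsum_eq_iSup_sum]
      obtain ⟨F, hF⟩ := lt_iSup_iff.1 hlt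
      exact ⟨F, tsub_le_iff_right.1 hF.le⟩
  have hδ3 : δ / 2 / (F.card + 1) ≠ 0 :=
    (ENNReal.div_pos hδ2 (ENNReal.add_ne_top.2 ⟨ENNReal.natCast_ne_top _, ENNReal.one_ne_top⟩)).ne'
  choose r hr1 hr2 using fun z => exists_rat_le_ennreal (x := g z)
    (ne_top_of_le_ne_top hg (ENNReal.le_tsum z)) hδ3
  refine ⟨Finsupp.onFinset F (fun z => if z ∈ F then r z else 0) (by simp +contextual),
    fun z => ?_, ?_⟩
  · simp only [Finsupp.onFinset_apply]
    split_ifs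
    · exact hr1 z
    · simp
  · calc ∑' z, g z ≤ ∑ z ∈ F, (ENNReal.ofReal (r z) + δ / 2 / (F.card + 1)) + δ / 2 := by
          refine hF.trans ?_
          gcongr with z _
          exact hr2 z
      _ ≤ ∑ z ∈ F, ENNReal.ofReal (r z) + δ / 2 + δ / 2 := by
          rw [Finset.sum_add_distrib, Finset.sum_const, nsmul_eq_mul]
          gcongr
          refine le_trans ?_ (ENNReal.mul_div_le (a := (F.card + 1 : ℝ≥0∞)) (b := δ / 2))
          gcongr
          exact le_self_add
      _ = ∑ z ∈ F, ENNReal.ofReal (r z) + δ := by rw [add_assoc, ENNReal.add_halves]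
      _ ≤ _ := by
          gcongr
          refine le_trans (le_of_eq ?_) (ENNReal.sum_le_tsum F)
          refine Finset.sum_congr rfl fun z hz => ?_
          simp [hz]

variable {E : Type*} [MetricSpace E] [MeasurableSpace E] [BorelSpace E]
  [SecondCountableTopology E]

lemma exists_measurable_nat_edist_le [Nonempty E] {δ : ℝ≥0∞} (hδ : δ ≠ 0) :
    ∃ t : E → ℕ, Measurable t ∧ ∀ x y, t x = t y → edist x y ≤ δ := by
  classical
  have hδ2 : 0 < δ / 2 := ENNReal.half_pos hδ
  have hex : ∀ x : E, ∃ n, edist x (TopologicalSpace.denseSeq E n) < δ / 2 := fun x => by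
    obtain ⟨_, ⟨n, rfl⟩, hy⟩ := EMetric.mem_closure_iff.1
      ((TopologicalSpace.denseRange_denseSeq E) x) _ hδ2
    exact ⟨n, hy⟩
  refine ⟨fun x => Nat.find (hex x), measurable_find hex fun k =>
    measurableSet_lt (by fun_prop) (by fun_prop), fun x y h => ?_⟩
  have hx := Nat.find_spec (hex x)
  have hy := Nat.find_spec (hex y)
  simp only at h
  rw [← h, edist_comm] at hy
  exact (edist_triangle _ _ _).trans ((add_le_add hx.le hy.le).trans (ENNReal.add_halves δ).le)

/-- Up to an arbitrarily small error the optimal transport cost is attained by one of countably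
many explicit couplings: those with density `couplingDensity`, for a fixed fine partition of the
space and a finitely supported rational matrix. -/
lemma exists_finsupp_couplingDensity (hbdd : ∀ x y : E, edist x y ≤ 1) {μ ν : Measure E}
    [IsProbabilityMeasure μ] [IsProbabilityMeasure ν] {c : ℝ≥0∞} (hc : W dist μ ν < c)
    {t : ℕ → E → ℕ} (ht : ∀ m, Measurable (t m))
    (htd : ∀ m x y, t m x = t m y → edist x y ≤ ((m : ℝ≥0∞) + 1)⁻¹) :
    ∃ (m : ℕ) (A : ℕ × ℕ →₀ ℚ),
      (∀ i, ∑' l, ENNReal.ofReal (A (i, l)) ≤ μ (t m ⁻¹' {i})) ∧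
      (∀ j, ∑' k, ENNReal.ofReal (A (k, j)) ≤ ν (t m ⁻¹' {j})) ∧
      ∑' k, ∑' l, ENNReal.ofReal (A (k, l)) < 1 ∧
      ∫⁻ z, edist z.1 z.2 ∂((μ.prod ν).withDensity fun z =>
        couplingDensity (fun k l => ENNReal.ofReal (A (k, l))) (fun i => μ (t m ⁻¹' {i}))
          (fun j => ν (t m ⁻¹' {j})) (t m z.1) (t m z.2)) ≤ c := by
  obtain ⟨γ, hγ, hlt⟩ := exists_coupling_of_W_lt hc
  have := hγ.isProbabilityMeasure
  set w := ∫⁻ p, edist p.1 p.2 ∂γ with hw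
  -- the error budget: a quarter for each of the four approximations
  obtain ⟨δ, hδ0, hδ⟩ : ∃ δ : ℝ≥0∞, δ ≠ 0 ∧ w + 4 * δ ≤ c := by
    rcases eq_or_ne c ∞ with rfl | hct
    · exact ⟨1, one_ne_zero, le_top⟩
    · refine ⟨(c - w) / 4, (ENNReal.div_pos (tsub_pos_of_lt hlt).ne' (by simp)).ne', ?_⟩
      calc w + 4 * ((c - w) / 4) ≤ w + (c - w) := by gcongr; exact ENNReal.mul_div_le
        _ = c := add_tsub_cancel_of_le hlt.le
  obtain ⟨m, hm⟩ : ∃ m : ℕ, ((m : ℝ≥0∞) + 1)⁻¹ ≤ δ := by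
    obtain ⟨m, hm⟩ := ENNReal.exists_inv_nat_lt hδ0
    exact ⟨m, le_trans (ENNReal.inv_le_inv.2 le_self_add) hm.le⟩
  set s := t m with hs
  have hsm : Measurable s := ht m
  set g : ℕ × ℕ → ℝ≥0∞ := fun k => γ (s ∘ Prod.fst ⁻¹' {k.1} ∩ s ∘ Prod.snd ⁻¹' {k.2}) with hg
  have hpair : Measurable fun z : E × E => (s z.1, s z.2) := by fun_prop
  have hgi : ∀ F : ℕ × ℕ → ℝ≥0∞, ∫⁻ z, F (s z.1, s z.2) ∂γ = ∑' k, F k * g k := by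
    intro F
    rw [← lintegral_map (measurable_of_countable F) hpair, lintegral_countable']
    refine tsum_congr fun k => ?_
    rw [Measure.map_apply hpair (measurableSet_singleton _)]
    congr 2
    ext z
    simp [Prod.ext_iff]
  have hg1 : ∑' k, g k = 1 := by simpa using (hgi fun _ => 1).symm
  obtain ⟨A, hA1, hA2⟩ := exists_finsupp_rat_le (g := fun k => (1 - δ) * g k)
    (by rw [ENNReal.tsum_mul_left, hg1]; finiteness) hδ0
  rw [ENNReal.tsum_mul_left, hg1, mul_one] at hA2
  have hAg : ∀ k, ENNReal.ofReal (A k) ≤ g k := fun k =>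
    (hA1 k).trans (mul_le_of_le_one_left' tsub_le_self)
  have hrow : ∀ i, ∑' l, ENNReal.ofReal (A (i, l)) ≤ μ (s ⁻¹' {i}) := by
    intro i
    calc _ ≤ ∑' l, g (i, l) := ENNReal.tsum_le_tsum fun l => hAg _
      _ = ∑' k, (if k.1 = i then 1 else 0) * g k := by
          symm
          rw [ENNReal.tsum_prod', tsum_eq_single i]
          · simp
          · intro b hb; simp [hb]
      _ = ∫⁻ z, (if s z.1 = i then 1 else 0) ∂γ := (hgi fun k => if k.1 = i then 1 else 0).symm
      _ = ∫⁻ x, (s ⁻¹' {i}).indicator 1 x ∂μ := by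
          rw [← hγ.lintegral_fst (measurable_one.indicator (hsm (measurableSet_singleton i)))]
          refine lintegral_congr fun z => ?_
          simp [indicator]
      _ = μ (s ⁻¹' {i}) := lintegral_indicator_one (hsm (measurableSet_singleton i))
  have hcol : ∀ j, ∑' k, ENNReal.ofReal (A (k, j)) ≤ ν (s ⁻¹' {j}) := by
    intro j
    calc _ ≤ ∑' k, g (k, j) := ENNReal.tsum_le_tsum fun l => hAg _
      _ = ∑' k, (if k.2 = j then 1 else 0) * g k := by
          rw [ENNReal.tsum_prod']
          refine tsum_congr fun k => ?_
          rw [tsum_eq_single j]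
          · simp
          · intro b hb; simp [hb]
      _ = ∫⁻ z, (if s z.2 = j then 1 else 0) ∂γ := (hgi fun k => if k.2 = j then 1 else 0).symm
      _ = ∫⁻ x, (s ⁻¹' {j}).indicator 1 x ∂ν := by
          rw [← hγ.lintegral_snd (measurable_one.indicator (hsm (measurableSet_singleton j)))]
          refine lintegral_congr fun z => ?_
          simp [indicator]
      _ = ν (s ⁻¹' {j}) := lintegral_indicator_one (hsm (measurableSet_singleton j))
  have hSeq : ∑' k, ∑' l, ENNReal.ofReal (A (k, l)) = ∑' k, ENNReal.ofReal (A k) :=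
    ENNReal.tsum_prod.symm
  have hS : ∑' k, ∑' l, ENNReal.ofReal (A (k, l)) < 1 := by
    rw [hSeq]
    calc _ ≤ ∑' k, (1 - δ) * g k := ENNReal.tsum_le_tsum hA1
      _ = 1 - δ := by rw [ENNReal.tsum_mul_left, hg1, mul_one]
      _ < 1 := ENNReal.sub_lt_self ENNReal.one_ne_top one_ne_zero hδ0
  refine ⟨m, A, hrow, hcol, hS, ?_⟩
  let D : ℕ → ℕ → ℝ≥0∞ := fun i j => ⨆ (x : E) (y : E) (_ : s x = i) (_ : s y = j), edist x y
  have hD1 : ∀ i j, D i j ≤ 1 := fun i j =>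
    iSup_le fun x => iSup_le fun y => iSup_le fun _ => iSup_le fun _ => hbdd x y
  have hDle : ∀ x y, edist x y ≤ D (s x) (s y) := fun x y =>
    le_iSup_of_le x (le_iSup_of_le y (le_iSup_of_le rfl (le_iSup_of_le rfl le_rfl)))
  have hDle' : ∀ x y, D (s x) (s y) ≤ edist x y + 2 * δ := by
    intro x y
    refine iSup_le fun x' => iSup_le fun y' => iSup_le fun hx => iSup_le fun hy => ?_
    calc edist x' y' ≤ edist x' x + edist x y + edist y y' := edist_triangle4 _ _ _ _
      _ ≤ δ + edist x y + δ := by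
          gcongr
          · exact (htd m _ _ hx).trans hm
          · exact (htd m _ _ hy.symm).trans hm
      _ = edist x y + 2 * δ := by ring
  refine (lintegral_edist_withDensity_le hsm (fun _ => rfl) (fun _ => rfl) hrow hcol hS hD1
    hDle).trans (le_trans ?_ hδ)
  calc _ ≤ ∑' k : ℕ × ℕ, D k.1 k.2 * g k + 2 * δ := by
        rw [hSeq]
        refine add_le_add ?_ ?_
        · rw [← ENNReal.tsum_prod (f := fun i j => ENNReal.ofReal (A (i, j)) * D i j)]
          refine ENNReal.tsum_le_tsum fun k => ?_
          rw [mul_comm]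
          gcongr
          exact hAg k
        · refine tsub_le_iff_left.2 ?_
          calc 1 ≤ 1 - δ + δ := le_tsub_add
            _ ≤ ∑' k, ENNReal.ofReal (A k) + δ + δ := by gcongr
            _ = _ := by ring
    _ = ∫⁻ z, D (s z.1) (s z.2) ∂γ + 2 * δ := by rw [hgi fun k => D k.1 k.2]
    _ ≤ ∫⁻ z, (edist z.1 z.2 + 2 * δ) ∂γ + 2 * δ := by
        gcongr with z
        exact hDle' _ _
    _ = w + 4 * δ := by
        rw [lintegral_add_right _ measurable_const]
        simp only [lintegral_const, measure_univ, mul_one, ← hw]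
        ring

lemma measurable_couplingDensity {α E : Type*} [MeasurableSpace α] [MeasurableSpace E]
    {a : ℕ → ℕ → ℝ≥0∞} {p q : α → ℕ → ℝ≥0∞} (hp : ∀ i, Measurable fun x => p x i)
    (hq : ∀ j, Measurable fun x => q x j) {t : E → ℕ} (ht : Measurable t) :
    Measurable fun x : α × (E × E) => couplingDensity a (p x.1) (q x.1) (t x.2.1) (t x.2.2) := by
  have h1 : Measurable fun x : α × (ℕ × ℕ) =>
      couplingDensity a (p x.1) (q x.1) x.2.1 x.2.2 := by
    refine measurable_from_prod_countable_left fun k => ?_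
    have h1 := hp k.1
    have h2 := hq k.2
    simp only [couplingDensity]
    refine Measurable.add (Measurable.div measurable_const (h1.mul h2)) (Measurable.div
      (Measurable.mul (Measurable.sub measurable_const ?_) (Measurable.sub measurable_const ?_))
      measurable_const)
    · exact Measurable.div measurable_const h1
    · exact Measurable.div measurable_const h2
  have h2 : Measurable fun x : α × (E × E) => (x.1, (t x.2.1, t x.2.2)) := by
    fun_prop
  exact h1.comp h2

/-- Measurable selection of couplings: if the transport cost between two Markov kernels is
pointwise below a measurable function `f`, then some kernel of couplings has cost at most `f`. -/
theorem exists_kernel_isCoupling [Nonempty E] (hbdd : ∀ x y : E, edist x y ≤ 1)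
    {α : Type*} [MeasurableSpace α] (κ η : Kernel α E) [IsMarkovKernel κ] [IsMarkovKernel η]
    {f : α → ℝ≥0∞} (hf : Measurable f) (hW : ∀ a, W dist (κ a) (η a) < f a) :
    ∃ Q : Kernel α (E × E), (∀ a, IsCoupling (Q a) (κ a) (η a)) ∧
      ∀ a, ∫⁻ z, edist z.1 z.2 ∂(Q a) ≤ f a := by
  classical
  have hpos : ∀ m : ℕ, ((m : ℝ≥0∞) + 1)⁻¹ ≠ 0 := fun m => by
    simp
  choose t ht htd using fun m : ℕ => exists_measurable_nat_edist_le (E := E) (hpos m)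
  let dens : ℕ × (ℕ × ℕ →₀ ℚ) → α → E × E → ℝ≥0∞ := fun R a z =>
    couplingDensity (fun k l => ENNReal.ofReal (R.2 (k, l))) (fun i => κ a (t R.1 ⁻¹' {i}))
      (fun j => η a (t R.1 ⁻¹' {j})) (t R.1 z.1) (t R.1 z.2)
  have hκm : ∀ m i, Measurable fun a => κ a (t m ⁻¹' {i}) := fun m i =>
    κ.measurable_coe (ht m (measurableSet_singleton i))
  have hηm : ∀ m i, Measurable fun a => η a (t m ⁻¹' {i}) := fun m i =>
    η.measurable_coe (ht m (measurableSet_singleton i))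
  have hdens : ∀ R, Measurable (Function.uncurry (dens R)) := by
    intro R
    exact measurable_couplingDensity (a := fun k l => ENNReal.ofReal (R.2 (k, l)))
      (hκm R.1) (hηm R.1) (ht R.1)
  let Q : ℕ × (ℕ × ℕ →₀ ℚ) → Kernel α (E × E) := fun R => (κ ×ₖ η).withDensity (dens R)
  have hQ : ∀ R a, Q R a = ((κ a).prod (η a)).withDensity (dens R a) := fun R a => by
    rw [Kernel.withDensity_apply _ (hdens R), Kernel.prod_apply]
  let good : ℕ × (ℕ × ℕ →₀ ℚ) → α → Prop := fun R a =>
    (∀ i, ∑' l, ENNReal.ofReal (R.2 (i, l)) ≤ κ a (t R.1 ⁻¹' {i})) ∧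
    (∀ j, ∑' k, ENNReal.ofReal (R.2 (k, j)) ≤ η a (t R.1 ⁻¹' {j})) ∧
    ∑' k, ∑' l, ENNReal.ofReal (R.2 (k, l)) < 1 ∧ ∫⁻ z, edist z.1 z.2 ∂(Q R a) ≤ f a
  have hgm : ∀ R, MeasurableSet {a | good R a} := by
    intro R
    have hset : {a | good R a} =
        (⋂ i, {a | ∑' l, ENNReal.ofReal (R.2 (i, l)) ≤ κ a (t R.1 ⁻¹' {i})}) ∩
        ((⋂ j, {a | ∑' k, ENNReal.ofReal (R.2 (k, j)) ≤ η a (t R.1 ⁻¹' {j})}) ∩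
        ({_a | ∑' k, ∑' l, ENNReal.ofReal (R.2 (k, l)) < 1} ∩
          {a | ∫⁻ z, edist z.1 z.2 ∂(Q R a) ≤ f a})) := by
      ext a
      simp only [good, mem_inter_iff, mem_iInter, mem_ofPred_eq]
    rw [hset]
    exact (MeasurableSet.iInter fun i => measurableSet_le measurable_const (hκm _ _)).inter
      ((MeasurableSet.iInter fun j => measurableSet_le measurable_const (hηm _ _)).inter
      ((MeasurableSet.const _).inter
        (measurableSet_le (Measurable.lintegral_kernel (by fun_prop)) hf)))
  obtain ⟨e, he⟩ := exists_surjective_nat (ℕ × (ℕ × ℕ →₀ ℚ))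
  have hex : ∀ a, ∃ n, good (e n) a := by
    intro a
    obtain ⟨m, A, h1, h2, h3, h4⟩ := exists_finsupp_couplingDensity hbdd (hW a) ht htd
    obtain ⟨n, hn⟩ := he (m, A)
    refine ⟨n, ?_⟩
    rw [hn]
    refine ⟨h1, h2, h3, ?_⟩
    rw [hQ]
    exact h4
  refine ⟨⟨fun a => Q (e (Nat.find (hex a))) a,
    Measurable.find (fun n => (Q (e n)).measurable) (fun n => hgm (e n)) hex⟩, fun a => ?_,
    fun a => ?_⟩
  · obtain ⟨h1, h2, h3, -⟩ := Nat.find_spec (hex a)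
    change IsCoupling (Q (e (Nat.find (hex a))) a) _ _
    rw [hQ]
    exact isCoupling_withDensity (ht _) (fun _ => rfl) (fun _ => rfl) h1 h2 h3
  · exact (Nat.find_spec (hex a)).2.2.2

end Selection

/-! ### Completeness of the Wasserstein distance -/

section Complete

open Preorder (frestrictLe)

lemma map_compProd_comap {α β δ : Type*} [MeasurableSpace α] [MeasurableSpace β]
    [MeasurableSpace δ] {m : Measure α} [SFinite m] {f : α → β} (hf : Measurable f)
    (κ : Kernel β δ) [IsSFiniteKernel κ] :
    (m ⊗ₘ κ.comap f hf).map (Prod.map f id) = (m.map f) ⊗ₘ κ := by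
  refine Measure.ext_of_lintegral _ fun g hg => ?_
  rw [lintegral_map hg (by fun_prop), Measure.lintegral_compProd (by fun_prop),
    Measure.lintegral_compProd hg, lintegral_map (by fun_prop) hf]
  rfl

variable {E : Type*} [MetricSpace E] [MeasurableSpace E] [BorelSpace E]
  [SecondCountableTopology E] [CompleteSpace E] [Nonempty E]

/-- Consecutive couplings of a sequence of laws are realised simultaneously by one sequence of
random variables, by the Ionescu-Tulcea theorem. -/
lemma exists_measure_pi_of_isCoupling {ν : ℕ → Measure E} [∀ n, IsProbabilityMeasure (ν n)]
    {γ : ℕ → Measure (E × E)} (hγ : ∀ n, IsCoupling (γ n) (ν n) (ν (n + 1))) :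
    ∃ m : Measure (ℕ → E), IsProbabilityMeasure m ∧ (∀ n, m.map (fun x => x n) = ν n) ∧
      ∀ n, m.map (fun x => (x n, x (n + 1))) = γ n := by
  have : ∀ n, IsProbabilityMeasure (γ n) := fun n => (hγ n).isProbabilityMeasure
  have hev : ∀ n : ℕ, Measurable fun x : (i : Finset.Iic n) → E =>
      x ⟨n, Finset.mem_Iic.2 (le_refl n)⟩ :=
    fun n => measurable_pi_apply _
  let κ : (n : ℕ) → Kernel ((i : Finset.Iic n) → (fun _ : ℕ => E) i) ((fun _ : ℕ => E) (n + 1)) :=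
    fun n => (γ n).condKernel.comap (fun x => x ⟨n, Finset.mem_Iic.2 (le_refl n)⟩) (hev n)
  have : ∀ n, IsMarkovKernel (κ n) := fun n => Kernel.IsMarkovKernel.comap _ (hev n)
  let m : Measure (ℕ → E) := Kernel.trajMeasure (X := fun _ => E) (ν 0) κ
  have hpair : ∀ n, m.map (fun x => x n) = ν n → m.map (fun x => (x n, x (n + 1))) = γ n := by
    intro n hn
    have h1 := Kernel.map_frestrictLe_trajMeasure_compProd_eq_map_trajMeasure
      (X := fun _ => E) (μ₀ := ν 0) (κ := κ) (a := n)
    have h2 := congrArg (Measure.map (Prod.map (fun x : (i : Finset.Iic n) → E =>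
      x ⟨n, Finset.mem_Iic.2 (le_refl n)⟩) id)) h1
    rw [Measure.map_map (by fun_prop) (by fun_prop)] at h2
    rw [map_compProd_comap (hev n) (γ n).condKernel,
      Measure.map_map (by fun_prop) (by fun_prop)] at h2
    refine Eq.trans h2.symm ?_
    refine Eq.trans ?_ ((γ n).disintegrate (γ n).condKernel)
    congr 1
    exact hn.trans (hγ n).1.symm
  have h0 : m.map (fun x => x 0) = ν 0 := by
    have hfr : m.map (frestrictLe 0) = (ν 0).map
        (MeasurableEquiv.piUnique (fun i : Finset.Iic 0 => (fun _ : ℕ => E) i)).symm := by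
      change (Kernel.trajMeasure (X := fun _ => E) (ν 0) κ).map (frestrictLe 0) = _
      rw [Kernel.trajMeasure, Measure.map_comp _ _ (by fun_prop), Kernel.traj_map_frestrictLe,
        Kernel.partialTraj_self, Measure.id_comp]
    have h2 := congrArg (Measure.map fun x : (i : Finset.Iic 0) → E =>
      x ⟨0, Finset.mem_Iic.2 (le_refl 0)⟩) hfr
    rw [Measure.map_map (hev 0) (by fun_prop), Measure.map_map (hev 0) (by fun_prop)] at h2
    refine Eq.trans h2 ?_
    exact Measure.map_id
  refine ⟨m, inferInstanceAs (IsProbabilityMeasure (Kernel.trajMeasure _ _)), ?_⟩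
  have hall : ∀ n, m.map (fun x => x n) = ν n := by
    intro n
    induction n with
    | zero => exact h0
    | succ n ih =>
      rw [← (hγ n).2, ← hpair n ih, Measure.map_map (by fun_prop) (by fun_prop)]
      rfl
  exact ⟨hall, fun n => hpair n (hall n)⟩

lemma exists_W_le_of_W_succ_lt {ν : ℕ → Measure E} [∀ n, IsProbabilityMeasure (ν n)]
    (h : ∀ n, W dist (ν n) (ν (n + 1)) < 2⁻¹ ^ n) :
    ∃ π : Measure E, IsProbabilityMeasure π ∧ ∀ n, W dist (ν n) π ≤ 2⁻¹ ^ n * 2 := by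
  choose γ hγ hlt using fun n => exists_coupling_of_W_lt (h n)
  obtain ⟨m, hm, hm1, hm2⟩ := exists_measure_pi_of_isCoupling hγ
  have hint : ∀ n, ∫⁻ x, edist (x n) (x (n + 1)) ∂m ≤ 2⁻¹ ^ n := by
    intro n
    refine le_trans (le_of_eq ?_) (hlt n).le
    rw [← hm2 n, lintegral_map (by fun_prop) (by fun_prop)]
  have hsum : ∀ n, ∫⁻ x, ∑' k, edist (x (n + k)) (x (n + k + 1)) ∂m ≤ 2⁻¹ ^ n * 2 := by
    intro n
    rw [lintegral_tsum fun k => by fun_prop]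
    calc _ ≤ ∑' k, (2⁻¹ : ℝ≥0∞) ^ (n + k) := ENNReal.tsum_le_tsum fun k => hint (n + k)
      _ = 2⁻¹ ^ n * 2 := by
        simp_rw [pow_add]
        rw [ENNReal.tsum_mul_left, ENNReal.tsum_geometric, ENNReal.one_sub_inv_two, inv_inv]
  have hae : ∀ᵐ x ∂m, ∑' k, edist (x k) (x (k + 1)) ≠ ∞ := by
    have h0 := hsum 0
    simp only [zero_add, pow_zero, one_mul] at h0
    refine (ae_lt_top (by fun_prop) (ne_top_of_le_ne_top ENNReal.ofNat_ne_top h0)).mono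
      fun x hx => hx.ne
  have hconv : ∀ᵐ x ∂m, ∃ l : E, Tendsto (fun n => x n) atTop (nhds l) := by
    filter_upwards [hae] with x hx
    exact cauchySeq_tendsto_of_complete
      (cauchySeq_of_edist_le_of_tsum_ne_top _ (fun _ => le_rfl) hx)
  obtain ⟨Y, hY, hYlim⟩ := measurable_limit_of_tendsto_metrizable_ae
    (f := fun n (x : ℕ → E) => x n) (fun n => (measurable_pi_apply n).aemeasurable) hconv
  refine ⟨m.map Y, Measure.isProbabilityMeasure_map hY.aemeasurable, fun n => ?_⟩
  have hc : IsCoupling (m.map fun x => (x n, Y x)) (ν n) (m.map Y) := by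
    constructor
    · rw [← hm1 n, Measure.map_map (by fun_prop) (by fun_prop)]
      rfl
    · rw [Measure.map_map (by fun_prop) (by fun_prop)]
      rfl
  refine hc.W_le.trans (le_trans ?_ (hsum n))
  rw [lintegral_map (by fun_prop) (by fun_prop)]
  refine lintegral_mono_ae ?_
  filter_upwards [hYlim] with x hx
  exact edist_le_tsum_of_edist_le_of_tendsto _ (fun _ => le_rfl) hx n

/-- A sequence of probability measures that is Cauchy for the Wasserstein distance converges. -/
theorem exists_tendsto_W {μ : ℕ → Measure E} [∀ n, IsProbabilityMeasure (μ n)]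
    (h : ∀ ε : ℝ≥0∞, 0 < ε → ∃ N, ∀ m ≥ N, ∀ n ≥ N, W dist (μ m) (μ n) < ε) :
    ∃ π : Measure E, IsProbabilityMeasure π ∧
      Tendsto (fun n => W dist (μ n) π) atTop (nhds 0) := by
  choose N hN using fun k : ℕ => h (2⁻¹ ^ k) (ENNReal.pow_pos (by simp) k)
  let s : ℕ → ℕ := fun k => (Finset.range (k + 1)).sup N
  have hs : ∀ k j, j ≤ k → N j ≤ s k := fun k j hjk =>
    Finset.le_sup (f := N) (Finset.mem_range.2 (Nat.lt_succ_of_le hjk))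
  obtain ⟨π, hπ, hW⟩ := exists_W_le_of_W_succ_lt (ν := fun k => μ (s k))
    fun k => hN k _ (hs k k le_rfl) _ (hs (k + 1) k (Nat.le_succ k))
  refine ⟨π, hπ, ENNReal.tendsto_nhds_zero.2 fun ε hε => ?_⟩
  have hlim : Tendsto (fun k : ℕ => (2⁻¹ : ℝ≥0∞) ^ k * 3) atTop (nhds 0) := by
    have := ENNReal.Tendsto.mul_const (b := (3 : ℝ≥0∞))
      (ENNReal.tendsto_pow_atTop_nhds_zero_of_lt_one ENNReal.one_half_lt_one)
      (Or.inr ENNReal.ofNat_ne_top)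
    simpa using this
  obtain ⟨k, hk⟩ := (ENNReal.tendsto_nhds_zero.1 hlim ε hε).exists
  filter_upwards [eventually_ge_atTop (N k)] with n hn
  calc W dist (μ n) π ≤ W dist (μ n) (μ (s k)) + W dist (μ (s k)) π := W_triangle
    _ ≤ 2⁻¹ ^ k + 2⁻¹ ^ k * 2 := add_le_add (hN k n hn _ (hs k k le_rfl)).le (hW k)
    _ = 2⁻¹ ^ k * 3 := by ring
    _ ≤ ε := hk

end Complete

/-! ### The flow of a concave rate function -/

section Rate

/-- The standing assumptions on the function `φ` of the drift condition. -/
structure IsRate (φ : ℝ → ℝ) : Prop where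
  map_zero : φ 0 = 0
  concaveOn : ConcaveOn ℝ (Ici 0) φ
  continuousOn : ContinuousOn φ (Ici 0)
  differentiableOn : DifferentiableOn ℝ φ (Ioi 0)
  strictMonoOn : StrictMonoOn φ (Ici 0)
  tendsto_top : Tendsto φ atTop atTop

/-- The flow at time `s` of the differential equation `u' = φ u`, started at `u ≥ 1`. -/
noncomputable def flow (φ : ℝ → ℝ) (s u : ℝ) : ℝ := HInv φ (H φ u + s)

variable {φ : ℝ → ℝ}

namespace IsRate

lemma mono (h : IsRate φ) {u v : ℝ} (hu : 0 ≤ u) (huv : u ≤ v) : φ u ≤ φ v :=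
  h.strictMonoOn.monotoneOn hu (hu.trans huv : (0 : ℝ) ≤ v) huv

lemma nonneg (h : IsRate φ) {u : ℝ} (hu : 0 ≤ u) : 0 ≤ φ u := by
  have := h.mono le_rfl hu
  rwa [h.map_zero] at this

lemma pos (h : IsRate φ) {u : ℝ} (hu : 0 < u) : 0 < φ u := by
  have := h.strictMonoOn (self_mem_Ici (a := (0 : ℝ))) hu.le hu
  rwa [h.map_zero] at this

lemma smul_le (h : IsRate φ) {t u : ℝ} (ht : 0 ≤ t) (ht1 : t ≤ 1) (hu : 0 ≤ u) :
    t * φ u ≤ φ (t * u) := by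
  have := h.concaveOn.2 (show u ∈ Ici (0 : ℝ) from hu) (self_mem_Ici (a := (0 : ℝ))) ht
    (sub_nonneg.2 ht1) (by ring)
  simpa [h.map_zero] using this

lemma add_le (h : IsRate φ) {u v : ℝ} (hu : 0 ≤ u) (hv : 0 ≤ v) : φ (u + v) ≤ φ u + φ v := by
  rcases eq_or_lt_of_le (add_nonneg hu hv) with h0 | h0
  · have h1 : u = 0 := by linarith
    have h2 : v = 0 := by linarith
    simp [h1, h2, h.map_zero]
  · have h1 := h.smul_le (t := u / (u + v)) (by positivity)
      ((div_le_one h0).2 (by linarith)) h0.le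
    have h2 := h.smul_le (t := v / (u + v)) (by positivity)
      ((div_le_one h0).2 (by linarith)) h0.le
    rw [div_mul_cancel₀ _ h0.ne'] at h1 h2
    calc φ (u + v) = u / (u + v) * φ (u + v) + v / (u + v) * φ (u + v) := by
          field_simp
      _ ≤ _ := add_le_add h1 h2

lemma le_mul (h : IsRate φ) {u : ℝ} (hu : 1 ≤ u) : φ u ≤ φ 1 * u := by
  have h0 : 0 < u := by linarith
  have h1 := h.smul_le (t := 1 / u) (by positivity) ((div_le_one h0).2 hu) h0.le
  rw [one_div_mul_cancel h0.ne', one_div, inv_mul_le_iff₀ h0] at h1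
  linarith

lemma hasDerivAt_H (h : IsRate φ) {u : ℝ} (hu : 0 < u) : HasDerivAt (H φ) (1 / φ u) u := by
  have hcont : ContinuousOn (fun u => 1 / φ u) (Ioi 0) :=
    continuousOn_const.div (h.continuousOn.mono Ioi_subset_Ici_self) fun x hx => (h.pos hx).ne'
  refine intervalIntegral.integral_hasDerivAt_right ?_ ?_ (hcont.continuousAt (Ioi_mem_nhds hu))
  · refine (hcont.mono ?_).intervalIntegrable
    intro x hx
    rw [mem_uIcc] at hx
    rcases hx with hx | hx
    · exact (zero_lt_one.trans_le hx.1 : (0 : ℝ) < x)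
    · exact (hu.trans_le hx.1 : (0 : ℝ) < x)
  · exact hcont.stronglyMeasurableAtFilter isOpen_Ioi u hu

lemma H_one : H φ 1 = 0 := by simp [H]

/-- The time needed by the flow to go from `w` to `u` is at least `(u - w) / φ u`. -/
lemma div_le_H_sub (h : IsRate φ) {w u : ℝ} (hw : 0 < w) (hwu : w ≤ u) :
    (u - w) / φ u ≤ H φ u - H φ w := by
  rcases eq_or_lt_of_le hwu with rfl | hlt
  · simp
  have hpos : ∀ x, w ≤ x → 0 < x := fun x hx => hw.trans_le hx
  obtain ⟨ξ, hξ, he⟩ := exists_hasDerivAt_eq_slope (H φ) (fun x => 1 / φ x) hlt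
    (fun x hx => (h.hasDerivAt_H (hpos x hx.1)).continuousAt.continuousWithinAt)
    (fun x hx => h.hasDerivAt_H (hpos x hx.1.le))
  have h0 : 0 < u - w := sub_pos.2 hlt
  rw [eq_div_iff h0.ne'] at he
  rw [← he, div_eq_inv_mul, one_div]
  have hξ0 := hpos ξ hξ.1.le
  exact mul_le_mul_of_nonneg_right
    (inv_anti₀ (h.pos hξ0) (h.mono hξ0.le hξ.2.le)) h0.le

lemma strictMonoOn_H (h : IsRate φ) : StrictMonoOn (H φ) (Ioi 0) := by
  intro w hw u hu hwu
  have h1 := h.div_le_H_sub hw hwu.le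
  have h2 : 0 < (u - w) / φ u := div_pos (sub_pos.2 hwu) (h.pos hu)
  linarith

lemma H_nonneg (h : IsRate φ) {u : ℝ} (hu : 1 ≤ u) : 0 ≤ H φ u := by
  rw [← H_one (φ := φ)]
  exact h.strictMonoOn_H.monotoneOn (zero_lt_one : (0 : ℝ) < 1)
    (zero_lt_one.trans_le hu : (0 : ℝ) < u) hu

lemma exists_le_H (h : IsRate φ) (y : ℝ) : ∃ u, 1 ≤ u ∧ y ≤ H φ u := by
  have hφ1 : 0 < φ 1 := h.pos one_pos
  -- each doubling of `u` takes at least the time `1 / (2 φ 1)`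
  have key : ∀ n : ℕ, n * (1 / (2 * φ 1)) ≤ H φ (2 ^ n) := by
    intro n
    induction n with
    | zero => simp [H_one]
    | succ n ih =>
      have hp : (1 : ℝ) ≤ 2 ^ n := one_le_pow₀ (by norm_num)
      have h2 : (2 : ℝ) ^ (n + 1) = 2 * 2 ^ n := by ring
      have h1 := h.div_le_H_sub (w := 2 ^ n) (u := 2 ^ (n + 1)) (by positivity) (by linarith)
      have h3 : 1 / (2 * φ 1) ≤ (2 ^ (n + 1) - 2 ^ n) / φ (2 ^ (n + 1)) := by
        rw [div_le_div_iff₀ (by positivity) (h.pos (by positivity))]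
        have := h.le_mul (u := 2 ^ (n + 1)) (by linarith)
        rw [h2] at this ⊢
        linarith
      push_cast
      linarith
  obtain ⟨n, hn⟩ := exists_nat_ge (y / (1 / (2 * φ 1)))
  refine ⟨2 ^ n, one_le_pow₀ (by norm_num), le_trans ?_ (key n)⟩
  rwa [div_le_iff₀ (by positivity)] at hn

lemma surjOn_H (h : IsRate φ) : SurjOn (H φ) (Ici 1) (Ici 0) := by
  intro y hy
  obtain ⟨u, hu, hyu⟩ := h.exists_le_H y
  have hc : ContinuousOn (H φ) (Icc 1 u) := fun x hx =>
    (h.hasDerivAt_H (zero_lt_one.trans_le hx.1)).continuousAt.continuousWithinAt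
  obtain ⟨x, hx, hxy⟩ := intermediate_value_Icc hu hc
    (show y ∈ Icc (H φ 1) (H φ u) from ⟨by rw [H_one]; exact hy, hyu⟩)
  exact ⟨x, hx.1, hxy⟩

lemma one_le_HInv (h : IsRate φ) {y : ℝ} (hy : 0 ≤ y) : 1 ≤ HInv φ y :=
  Function.invFunOn_mem (h.surjOn_H hy)

lemma H_HInv (h : IsRate φ) {y : ℝ} (hy : 0 ≤ y) : H φ (HInv φ y) = y :=
  Function.invFunOn_eq (h.surjOn_H hy)

lemma HInv_le_iff (h : IsRate φ) {y u : ℝ} (hy : 0 ≤ y) (hu : 1 ≤ u) :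
    HInv φ y ≤ u ↔ y ≤ H φ u := by
  conv_rhs => rw [← h.H_HInv hy]
  exact (h.strictMonoOn_H.le_iff_le
    (zero_lt_one.trans_le (h.one_le_HInv hy) : (0 : ℝ) < HInv φ y)
    (zero_lt_one.trans_le hu : (0 : ℝ) < u)).symm

lemma HInv_H (h : IsRate φ) {u : ℝ} (hu : 1 ≤ u) : HInv φ (H φ u) = u :=
  h.strictMonoOn_H.injOn (zero_lt_one.trans_le (h.one_le_HInv (h.H_nonneg hu)) : (0 : ℝ) < _)
    (zero_lt_one.trans_le hu : (0 : ℝ) < u) (h.H_HInv (h.H_nonneg hu))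

lemma strictMonoOn_HInv (h : IsRate φ) : StrictMonoOn (HInv φ) (Ici 0) := by
  intro x hx y hy hxy
  by_contra! hle
  rw [h.HInv_le_iff hy (h.one_le_HInv hx), h.H_HInv hx] at hle
  linarith

lemma HInv_mono (h : IsRate φ) {x y : ℝ} (hx : 0 ≤ x) (hxy : x ≤ y) : HInv φ x ≤ HInv φ y :=
  h.strictMonoOn_HInv.monotoneOn hx (hx.trans hxy : (0 : ℝ) ≤ y) hxy

lemma tendsto_HInv (h : IsRate φ) : Tendsto (HInv φ) atTop atTop := by
  refine Filter.tendsto_atTop.2 fun b => ?_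
  filter_upwards [eventually_ge_atTop (H φ (max b 1))] with y hy
  have h1 : 1 ≤ max b 1 := le_max_right _ _
  calc b ≤ max b 1 := le_max_left _ _
    _ = HInv φ (H φ (max b 1)) := (h.HInv_H h1).symm
    _ ≤ HInv φ y := h.HInv_mono (h.H_nonneg h1) hy

lemma hasDerivAt_HInv (h : IsRate φ) {y : ℝ} (hy : 0 < y) :
    HasDerivAt (HInv φ) (φ (HInv φ y)) y := by
  have hHy : 1 < HInv φ y := by
    have := h.strictMonoOn_HInv (self_mem_Ici (a := (0 : ℝ))) hy.le hy
    exact (h.one_le_HInv le_rfl).trans_lt this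
  have himg : HInv φ '' Ici 0 = Ici 1 := by
    ext u
    constructor
    · rintro ⟨x, hx, rfl⟩
      exact h.one_le_HInv hx
    · intro hu
      exact ⟨H φ u, h.H_nonneg hu, h.HInv_H hu⟩
  have hcont : ContinuousAt (HInv φ) y :=
    h.strictMonoOn_HInv.continuousAt_of_image_mem_nhds (Ici_mem_nhds hy)
      (by rw [himg]; exact Ici_mem_nhds hHy)
  have hd := h.hasDerivAt_H (zero_lt_one.trans hHy)
  have hpos := h.pos (zero_lt_one.trans hHy)
  have := HasDerivAt.of_local_left_inverse hcont hd (by positivity)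
    (by filter_upwards [Ioi_mem_nhds hy] with z hz using h.H_HInv (le_of_lt hz))
  simpa using this

lemma one_le_flow (h : IsRate φ) {s u : ℝ} (hs : 0 ≤ s) (hu : 1 ≤ u) : 1 ≤ flow φ s u :=
  h.one_le_HInv (add_nonneg (h.H_nonneg hu) hs)

lemma flow_zero (h : IsRate φ) {u : ℝ} (hu : 1 ≤ u) : flow φ 0 u = u := by
  rw [flow, add_zero, h.HInv_H hu]

lemma HInv_le_flow (h : IsRate φ) {s u : ℝ} (hs : 0 ≤ s) (hu : 1 ≤ u) :
    HInv φ s ≤ flow φ s u :=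
  h.HInv_mono hs (le_add_of_nonneg_left (h.H_nonneg hu))

lemma le_flow (h : IsRate φ) {s u : ℝ} (hs : 0 ≤ s) (hu : 1 ≤ u) : u ≤ flow φ s u := by
  conv_lhs => rw [← h.HInv_H hu]
  exact h.HInv_mono (h.H_nonneg hu) (le_add_of_nonneg_right hs)

lemma flow_mono (h : IsRate φ) {s u v : ℝ} (hs : 0 ≤ s) (hu : 1 ≤ u) (huv : u ≤ v) :
    flow φ s u ≤ flow φ s v :=
  h.HInv_mono (add_nonneg (h.H_nonneg hu) hs) (add_le_add_left
    (h.strictMonoOn_H.monotoneOn (zero_lt_one.trans_le hu : (0 : ℝ) < u)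
      (zero_lt_one.trans_le (hu.trans huv) : (0 : ℝ) < v) huv) _)

/-- A decrease of the starting point by `c φ u` compensates an additional time `c` of the flow. -/
lemma flow_add_le (h : IsRate φ) {s c w u : ℝ} (hs : 0 ≤ s) (hc : 0 ≤ c) (hw : 1 ≤ w)
    (hu : 0 ≤ u) (hwu : w + c * φ u ≤ u) : flow φ (s + c) w ≤ flow φ s u := by
  have hw0 : 0 < w := by linarith
  have huw : w ≤ u := by linarith [mul_nonneg hc (h.nonneg hu)]
  have hu0 : 0 < φ u := h.pos (hw0.trans_le huw)
  have h1 := h.div_le_H_sub hw0 huw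
  have h2 : c ≤ (u - w) / φ u := by
    rw [le_div_iff₀ hu0]
    linarith
  refine h.HInv_mono (add_nonneg (h.H_nonneg hw) (add_nonneg hs hc)) ?_
  linarith

lemma hasDerivAt_flow (h : IsRate φ) {s u : ℝ} (hs : 0 < s) (hu : 1 ≤ u) :
    HasDerivAt (flow φ s) (φ (flow φ s u) / φ u) u := by
  have h1 := (h.hasDerivAt_H (zero_lt_one.trans_le hu)).add_const s
  have h2 := h.hasDerivAt_HInv (add_pos_of_nonneg_of_pos (h.H_nonneg hu) hs)
  rw [div_eq_mul_one_div]
  exact h2.comp u h1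

/-- The flow is concave in the starting point. -/
lemma concaveOn_flow (h : IsRate φ) {s : ℝ} (hs : 0 ≤ s) : ConcaveOn ℝ (Ici 1) (flow φ s) := by
  rcases eq_or_lt_of_le hs with rfl | hs'
  · exact (concaveOn_id (convex_Ici 1)).congr fun u hu => (h.flow_zero hu).symm
  have hdiff : ∀ u ∈ Ici (1 : ℝ), HasDerivAt (flow φ s) (φ (flow φ s u) / φ u) u :=
    fun u hu => h.hasDerivAt_flow hs' hu
  have hφd : ∀ u, 0 < u → HasDerivAt φ (deriv φ u) u := fun u hu =>
    ((h.differentiableOn u hu).differentiableAt (Ioi_mem_nhds hu)).hasDerivAt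
  have hanti : AntitoneOn (deriv φ) (Ioi 0) :=
    (h.concaveOn.subset Ioi_subset_Ici_self (convex_Ioi 0)).antitoneOn_deriv
      fun u hu => (hφd u hu).differentiableAt
  refine AntitoneOn.concaveOn_of_deriv (convex_Ici 1)
    (fun u hu => (hdiff u hu).continuousAt.continuousWithinAt)
    (fun u hu => (hdiff u (interior_subset hu)).differentiableAt.differentiableWithinAt) ?_
  rw [interior_Ici]
  have heq : EqOn (fun u => φ (flow φ s u) / φ u) (deriv (flow φ s)) (Ioi 1) :=
    fun u hu => (hdiff u (mem_Ici.2 (le_of_lt hu))).deriv.symm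
  refine AntitoneOn.congr ?_ heq
  have hd2 : ∀ u ∈ Ioi (1 : ℝ), HasDerivAt (fun u => φ (flow φ s u) / φ u)
      ((deriv φ (flow φ s u) * (φ (flow φ s u) / φ u) * φ u - φ (flow φ s u) * deriv φ u)
        / φ u ^ 2) u := by
    intro u hu
    have hu1 : 1 ≤ u := le_of_lt hu
    have hu0 : 0 < u := by linarith
    have hf0 : 0 < flow φ s u := zero_lt_one.trans_le (h.one_le_flow hs hu1)
    exact ((hφd _ hf0).comp u (hdiff u hu1)).div (hφd u hu0) (h.pos hu0).ne'
  refine antitoneOn_of_deriv_nonpos (convex_Ioi 1)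
    (fun u hu => (hd2 u hu).continuousAt.continuousWithinAt)
    (fun u hu => (hd2 u (interior_subset hu)).differentiableAt.differentiableWithinAt) ?_
  intro u hu
  have hu := interior_subset hu
  have hu1 : 1 ≤ u := le_of_lt hu
  have hu0 : 0 < u := by linarith
  have hf0 : 0 < flow φ s u := zero_lt_one.trans_le (h.one_le_flow hs hu1)
  rw [(hd2 u hu).deriv]
  refine div_nonpos_of_nonpos_of_nonneg ?_ (sq_nonneg _)
  rw [mul_assoc, div_mul_cancel₀ _ (h.pos hu0).ne', mul_comm, ← mul_sub]
  exact mul_nonpos_of_nonneg_of_nonpos (h.pos hf0).le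
    (sub_nonpos.2 (hanti hu0 hf0 (h.le_flow hs hu1)))

/-- By concavity the flow started at `v` exceeds the flow started at `M` at most by a factor that
is close to `1` when `M` is large and `v - M` is bounded. -/
lemma flow_le_mul_flow (h : IsRate φ) {s M v : ℝ} (hs : 0 ≤ s) (hM : 1 < M) (hMv : M ≤ v) :
    flow φ s v ≤ (v - 1) / (M - 1) * flow φ s M := by
  have hM0 : 0 < M - 1 := by linarith
  have hv0 : 0 < v - 1 := by linarith
  have ha : 0 ≤ (v - M) / (v - 1) := div_nonneg (by linarith) hv0.le
  have hb : 0 ≤ (M - 1) / (v - 1) := by positivity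
  have hab : (v - M) / (v - 1) + (M - 1) / (v - 1) = 1 := by field_simp; ring
  have hconc := (h.concaveOn_flow hs).2 (mem_Ici.2 (le_refl (1 : ℝ)))
    (mem_Ici.2 (hM.le.trans hMv)) ha hb hab
  have e : ((v - M) / (v - 1)) • (1 : ℝ) + ((M - 1) / (v - 1)) • v = M := by
    simp only [smul_eq_mul]; field_simp; ring
  rw [e] at hconc
  simp only [smul_eq_mul] at hconc
  have h1 : 0 ≤ (v - M) / (v - 1) * flow φ s 1 :=
    mul_nonneg ha
      (zero_le_one.trans (h.one_le_flow hs le_rfl))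
  have h2 : (M - 1) / (v - 1) * flow φ s v ≤ flow φ s M := by linarith
  calc flow φ s v = (v - 1) / (M - 1) * ((M - 1) / (v - 1) * flow φ s v) := by field_simp
    _ ≤ _ := mul_le_mul_of_nonneg_left h2 (by positivity)

end IsRate

end Rate

/-! ### Jensen's inequality for the flow -/

section Jensen

variable {φ : ℝ → ℝ} {Ω : Type*} [MeasurableSpace Ω]

lemma IsRate.measurable_flow_comp (h : IsRate φ) {s : ℝ} (hs : 0 ≤ s) {Z : Ω → ℝ}
    (hZ : Measurable Z) (hZ1 : ∀ ω, 1 ≤ Z ω) : Measurable fun ω => flow φ s (Z ω) := by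
  have hmono : Monotone fun z => flow φ s (max 1 z) := fun a b hab =>
    h.flow_mono hs (le_max_left _ _) (max_le_max le_rfl hab)
  have heq : (fun ω => flow φ s (Z ω)) = (fun z => flow φ s (max 1 z)) ∘ Z := by
    funext ω
    simp [max_eq_right (hZ1 ω)]
  rw [heq]
  exact hmono.measurable.comp hZ

lemma IsRate.continuousOn_flow (h : IsRate φ) {s : ℝ} (hs : 0 ≤ s) :
    ContinuousOn (flow φ s) (Ici 1) := by
  rcases eq_or_lt_of_le hs with rfl | hs'
  · exact continuousOn_id.congr fun u hu => h.flow_zero hu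
  · exact fun u hu => (h.hasDerivAt_flow hs' hu).continuousAt.continuousWithinAt

lemma IsRate.lintegral_flow_le (h : IsRate φ) {s : ℝ} (hs : 0 ≤ s) {m : Measure Ω}
    [IsProbabilityMeasure m] {Z : Ω → ℝ} (hZ : Measurable Z) (hZ1 : ∀ ω, 1 ≤ Z ω)
    (hint : Integrable Z m) :
    ∫⁻ ω, ENNReal.ofReal (flow φ s (Z ω)) ∂m ≤ ENNReal.ofReal (flow φ s (∫ ω, Z ω ∂m)) := by
  have hmeas := h.measurable_flow_comp hs hZ hZ1
  have hnn : ∀ ω, 0 ≤ flow φ s (Z ω) := fun ω =>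
    zero_le_one.trans (h.one_le_flow hs (hZ1 ω))
  have hbound : ∀ ω, flow φ s (Z ω) ≤ (1 + Z ω) * flow φ s 2 := by
    intro ω
    have h2 : 0 ≤ flow φ s 2 := zero_le_one.trans (h.one_le_flow hs one_le_two)
    rcases le_total (Z ω) 2 with hz | hz
    · exact (h.flow_mono hs (hZ1 ω) hz).trans
        (le_mul_of_one_le_left h2 (by linarith [hZ1 ω]))
    · refine (h.flow_le_mul_flow hs one_lt_two hz).trans ?_
      exact mul_le_mul_of_nonneg_right (by norm_num; linarith) h2
  have hfint : Integrable (fun ω => flow φ s (Z ω)) m := by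
    refine Integrable.mono' (((integrable_const 1).add hint).mul_const (flow φ s 2))
      hmeas.aestronglyMeasurable (Eventually.of_forall fun ω => ?_)
    rw [Real.norm_of_nonneg (hnn ω)]
    exact hbound ω
  rw [← ofReal_integral_eq_lintegral_ofReal hfint (Eventually.of_forall hnn)]
  exact ENNReal.ofReal_le_ofReal ((h.concaveOn_flow hs).le_map_integral (h.continuousOn_flow hs)
    isClosed_Ici (Eventually.of_forall hZ1) hint hfint)

end Jensen

/-! ### Drift of the flow along the coupled chain -/

section Drift

variable {φ : ℝ → ℝ}

/-- Choice of the shift `M` and of the speed `c`: along the drift inequality for `M + v` the flow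
does not increase outside of the small set, and increases at most by the factor `θ` on it. -/
lemma IsRate.exists_shift_speed (h : IsRate φ) {K R θ : ℝ} (hK : 0 ≤ K) (hR0 : 0 ≤ R)
    (hR : 2 * K < φ R) (hθ : 1 < θ) :
    ∃ M c : ℝ, 1 < M ∧ 0 < c ∧ ∀ s v w : ℝ, 0 ≤ s → 0 ≤ v → M ≤ w → w ≤ M + v - φ v + 2 * K →
      (R < v → flow φ (s + c) w ≤ flow φ s (M + v)) ∧
      (v ≤ R → flow φ (s + c) w ≤ θ * flow φ s (M + v)) := by
  have hθ0 : 0 < θ - 1 := by linarith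
  set M := 1 + (R + 2 * K + 1) / (θ - 1) with hMdef
  have hM : 1 < M := by
    have : 0 < (R + 2 * K + 1) / (θ - 1) := by positivity
    linarith
  have hMθ : (M + R + 2 * K + 1 - 1) / (M - 1) = θ := by
    have : M - 1 ≠ 0 := by linarith
    rw [div_eq_iff this, hMdef]
    field_simp
    ring
  have hφM : 0 < φ M := h.pos (by linarith)
  have hφ1 : 0 < φ (M + R + 2 * K + 1) := h.pos (by linarith)
  have hφR : 0 < φ R := by linarith
  set c := min ((φ R - 2 * K) / (φ R + φ M)) (1 / φ (M + R + 2 * K + 1)) with hc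
  have hc0 : 0 < c := lt_min (div_pos (by linarith) (by linarith)) (by positivity)
  refine ⟨M, c, hM, hc0, fun s v w hs hv hMw hw => ⟨fun hRv => ?_, fun hvR => ?_⟩⟩
  · refine h.flow_add_le hs hc0.le (hM.le.trans hMw) (by linarith) ?_
    have hφv : φ R ≤ φ v := h.mono hR0 hRv.le
    have h1 : c * φ (M + v) ≤ φ v - 2 * K := by
      calc c * φ (M + v) ≤ (φ R - 2 * K) / (φ R + φ M) * (φ M + φ v) :=
            mul_le_mul (min_le_left _ _) (h.add_le (by linarith) hv)
              (h.nonneg (by linarith)) (div_nonneg (by linarith) (by linarith))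
        _ ≤ φ v - 2 * K := by
            rw [div_mul_eq_mul_div, div_le_iff₀ (by linarith)]
            nlinarith [mul_nonneg (sub_nonneg.2 hφv) (add_nonneg hφM.le (by linarith : 0 ≤ 2 * K))]
    linarith
  · have hw1 : w ≤ M + R + 2 * K := by linarith [h.nonneg hv]
    have hc1 : c * φ (M + R + 2 * K + 1) ≤ 1 := by
      rw [← le_div_iff₀ hφ1]
      exact min_le_right _ _
    have hf0 : 0 ≤ θ := by linarith
    calc flow φ (s + c) w ≤ flow φ (s + c) (M + R + 2 * K) :=
          h.flow_mono (by linarith) (by linarith) hw1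
      _ ≤ flow φ s (M + R + 2 * K + 1) :=
          h.flow_add_le hs hc0.le (by linarith) (by linarith) (by linarith)
      _ ≤ (M + R + 2 * K + 1 - 1) / (M - 1) * flow φ s M :=
          h.flow_le_mul_flow hs hM (by linarith)
      _ = θ * flow φ s M := by rw [hMθ]
      _ ≤ θ * flow φ s (M + v) :=
          mul_le_mul_of_nonneg_left (h.flow_mono hs hM.le (by linarith)) hf0

end Drift

/-! ### Contraction for a weighted cost -/

section Contraction

variable {E : Type*} [MetricSpace E] [MeasurableSpace E] [BorelSpace E]
  [SecondCountableTopology E]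

/-- Under the contraction hypotheses, for every `δ > 0` the transition kernel can be coupled with
itself so that the expected distance shrinks by `1 - ρ` on the small set and does not grow
elsewhere, up to the factor `1 + δ`. -/
lemma exists_coupling_kernel [Nonempty E] {P : Kernel E E} [IsMarkovKernel P]
    (hbdd : ∀ x y : E, edist x y ≤ 1) {V : E → ℝ} (hV : Measurable V) {R ρ : ℝ}
    (hρ0 : 0 ≤ ρ) (hρ1 : ρ < 1) (hcontr : ∀ x y, W dist (P x) (P y) ≤ edist x y)
    (hsmall : ∀ x y, V x + V y ≤ R → W dist (P x) (P y) ≤ ENNReal.ofReal (1 - ρ) * edist x y)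
    {δ : ℝ≥0∞} (hδ : δ ≠ 0) :
    ∃ Q : Kernel (E × E) (E × E), (∀ p, IsCoupling (Q p) (P p.1) (P p.2)) ∧
      (∀ p, ∫⁻ z, edist z.1 z.2 ∂(Q p) ≤ (1 + δ) * edist p.1 p.2) ∧
      ∀ p, V p.1 + V p.2 ≤ R →
        ∫⁻ z, edist z.1 z.2 ∂(Q p) ≤ (1 + δ) * (ENNReal.ofReal (1 - ρ) * edist p.1 p.2) := by
  classical
  have hdiag : MeasurableSet {p : E × E | p.1 = p.2} := measurableSet_eq_fun (by fun_prop)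
    (by fun_prop)
  have hsm : MeasurableSet {p : E × E | V p.1 + V p.2 ≤ R} :=
    measurableSet_le (by fun_prop) measurable_const
  let b : E × E → ℝ≥0∞ := fun p =>
    if V p.1 + V p.2 ≤ R then ENNReal.ofReal (1 - ρ) * edist p.1 p.2 else edist p.1 p.2
  have hb : Measurable b := Measurable.ite hsm (by fun_prop) (by fun_prop)
  have hWb : ∀ p, W dist (P p.1) (P p.2) ≤ b p := by
    intro p
    simp only [b]
    split_ifs with hp
    · exact hsmall _ _ hp
    · exact hcontr _ _
  have hbpos : ∀ p : E × E, p.1 ≠ p.2 → b p ≠ 0 := by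
    intro p hp
    have h1 : edist p.1 p.2 ≠ 0 := by simpa [edist_eq_zero] using hp
    have h2 : ENNReal.ofReal (1 - ρ) ≠ 0 := by simpa using hρ1
    simp only [b]
    split_ifs
    · exact mul_ne_zero h2 h1
    · exact h1
  have hbtop : ∀ p, b p ≠ ∞ := by
    intro p
    have := edist_ne_top p.1 p.2
    simp only [b]
    split_ifs
    · exact ENNReal.mul_ne_top ENNReal.ofReal_ne_top this
    · exact this
  let f : E × E → ℝ≥0∞ := fun p => if p.1 = p.2 then 2 else (1 + δ) * b p
  obtain ⟨Q₀, hQ₀, hQ₀f⟩ := exists_kernel_isCoupling hbdd (P.comap Prod.fst measurable_fst)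
    (P.comap Prod.snd measurable_snd) (f := f) (Measurable.ite hdiag measurable_const (by fun_prop))
    (by
      intro p
      simp only [f, Kernel.comap_apply]
      split_ifs with hp
      · exact (hWb p).trans_lt (lt_of_le_of_lt
          (by
            simp only [b, hp, edist_self, mul_zero, ite_self]
            exact le_rfl) (by norm_num : (0 : ℝ≥0∞) < 2))
      · refine (hWb p).trans_lt ?_
        rw [add_mul, one_mul]
        exact ENNReal.lt_add_right (hbtop p) (mul_ne_zero hδ (hbpos p hp)))
  have hdm : Measurable fun x : E => (x, x) := by fun_prop
  let Q : Kernel (E × E) (E × E) :=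
    Kernel.piecewise hdiag ((P.map fun x => (x, x)).comap Prod.fst measurable_fst) Q₀
  have hQ : ∀ p, IsCoupling (Q p) (P p.1) (P p.2) := by
    intro p
    simp only [Q, Kernel.piecewise_apply]
    split_ifs with hp
    · have hp' : p.1 = p.2 := hp
      rw [Kernel.comap_apply, Kernel.map_apply _ hdm, ← hp']
      exact isCoupling_diag
    · exact hQ₀ p
  have hcost : ∀ p, ∫⁻ z, edist z.1 z.2 ∂(Q p) ≤ (1 + δ) * b p := by
    intro p
    simp only [Q, Kernel.piecewise_apply]
    split_ifs with hp
    · rw [Kernel.comap_apply, Kernel.map_apply _ hdm, lintegral_map (by fun_prop) hdm]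
      simp
    · refine (hQ₀f p).trans ?_
      simp only [f, if_neg (show ¬ p.1 = p.2 from hp), le_refl]
  refine ⟨Q, hQ, fun p => (hcost p).trans ?_, fun p hp => (hcost p).trans ?_⟩
  · gcongr
    simp only [b]
    split_ifs
    · exact mul_le_of_le_one_left' (ENNReal.ofReal_le_one.2 (by linarith))
    · exact le_rfl
  · simp only [b, if_pos hp, le_refl]

/-- The cost `d(x, y) ^ e * G_s(M + V x + V y) ^ (1 - e)`, where `G` is the flow of `φ`. It
interpolates between the distance, which contracts on the small set, and the flow of the Lyapunov
function, which does not increase along the chain outside of the small set. -/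
noncomputable def flowCost (φ : ℝ → ℝ) (V : E → ℝ) (M e s : ℝ) (p : E × E) : ℝ≥0∞ :=
  edist p.1 p.2 ^ e * ENNReal.ofReal (flow φ s (M + (V p.1 + V p.2))) ^ (1 - e)

variable {φ : ℝ → ℝ} {V : E → ℝ} {M e : ℝ}

lemma measurable_flowCost (h : IsRate φ) (hV : Measurable V) (hV0 : ∀ x, 0 ≤ V x) (hM : 1 < M)
    {s : ℝ} (hs : 0 ≤ s) : Measurable (flowCost φ V M e s) := by
  have h1 : Measurable fun p : E × E => flow φ s (M + (V p.1 + V p.2)) :=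
    h.measurable_flow_comp hs (by fun_prop)
      fun p => by linarith [hV0 p.1, hV0 p.2]
  unfold flowCost
  fun_prop

/-- One step of the coupled chain, by Hölder's inequality for the two factors of the cost and
Jensen's inequality for the flow. -/
lemma lintegral_flowCost_le (h : IsRate φ) (hV : Measurable V) (hV0 : ∀ x, 0 ≤ V x)
    (he0 : 0 ≤ e) (he1 : e ≤ 1) (hM : 1 < M) {μ ν : Measure E} [IsProbabilityMeasure μ]
    (hμ : Integrable V μ) (hν : Integrable V ν) {m : Measure (E × E)} (hm : IsCoupling m μ ν)
    {s : ℝ} (hs : 0 ≤ s) :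
    ∫⁻ p, flowCost φ V M e s p ∂m ≤ (∫⁻ p, edist p.1 p.2 ∂m) ^ e *
      ENNReal.ofReal (flow φ s (M + (∫ x, V x ∂μ + ∫ x, V x ∂ν))) ^ (1 - e) := by
  have := hm.isProbabilityMeasure
  have hU1 : ∀ p : E × E, 1 ≤ M + (V p.1 + V p.2) := fun p => by
    linarith [hV0 p.1, hV0 p.2]
  have h1 : Measurable fun p : E × E => flow φ s (M + (V p.1 + V p.2)) :=
    h.measurable_flow_comp hs (by fun_prop) hU1
  have hi1 : Integrable (fun p : E × E => V p.1) m := by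
    rw [← hm.1] at hμ
    exact hμ.comp_measurable measurable_fst
  have hi2 : Integrable (fun p : E × E => V p.2) m := by
    rw [← hm.2] at hν
    exact hν.comp_measurable measurable_snd
  have he : ∫ p : E × E, M + (V p.1 + V p.2) ∂m = M + (∫ x, V x ∂μ + ∫ x, V x ∂ν) := by
    have e1 : ∫ p : E × E, V p.1 ∂m = ∫ x, V x ∂μ := by
      rw [← hm.1, integral_map (by fun_prop) hV.aestronglyMeasurable]
    have e2 : ∫ p : E × E, V p.2 ∂m = ∫ x, V x ∂ν := by
      rw [← hm.2, integral_map (by fun_prop) hV.aestronglyMeasurable]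
    have e3 : ∫ p : E × E, M + (V p.1 + V p.2) ∂m =
        ∫ _, M ∂m + ∫ p : E × E, V p.1 + V p.2 ∂m :=
      integral_add (integrable_const _) (hi1.add hi2)
    rw [e3, integral_add hi1 hi2, e1, e2]
    simp
  refine (ENNReal.lintegral_mul_norm_pow_le (by fun_prop) h1.ennreal_ofReal.aemeasurable he0
    (sub_nonneg.2 he1) (by ring)).trans ?_
  refine mul_le_mul_right (ENNReal.rpow_le_rpow ?_ (sub_nonneg.2 he1)) _
  rw [← he]
  exact h.lintegral_flow_le hs (by fun_prop) hU1 ((integrable_const _).add (hi1.add hi2))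

/-- The weighted cost does not increase along the coupled chain when the time of the flow advances
by `c` at each step. -/
lemma exists_flowCost_step (h : IsRate φ) {P : Kernel E E} [IsMarkovKernel P]
    (hV : Measurable V) (hV0 : ∀ x, 0 ≤ V x) {K R ρ : ℝ} (hK : 0 ≤ K)
    (hdrift : ∀ x, Integrable V (P x) ∧ ∫ y, V y ∂(P x) ≤ V x - φ (V x) + K)
    (hR0 : 0 ≤ R) (hR : 2 * K < φ R) (hρ0 : 0 < ρ) (hρ1 : ρ < 1) (he0 : 0 < e) (he1 : e < 1) :
    ∃ M c : ℝ, 1 < M ∧ 0 < c ∧ ∀ (δ : ℝ≥0∞) (Q : Kernel (E × E) (E × E)),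
      (∀ p, IsCoupling (Q p) (P p.1) (P p.2)) →
      (∀ p, ∫⁻ z, edist z.1 z.2 ∂(Q p) ≤ (1 + δ) * edist p.1 p.2) →
      (∀ p, V p.1 + V p.2 ≤ R →
        ∫⁻ z, edist z.1 z.2 ∂(Q p) ≤ (1 + δ) * (ENNReal.ofReal (1 - ρ) * edist p.1 p.2)) →
      ∀ s, 0 ≤ s → ∀ p,
        ∫⁻ z, flowCost φ V M e (s + c) z ∂(Q p) ≤ (1 + δ) * flowCost φ V M e s p := by
  -- the growth `θ` allowed on the small set is compensated by the contraction there
  set θ := (1 - ρ) ^ (-(e / (1 - e))) with hθdef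
  have hρ' : 0 < 1 - ρ := by linarith
  have he' : 0 < 1 - e := by linarith
  have hθ : 1 < θ := Real.one_lt_rpow_of_pos_of_lt_one_of_neg hρ' (by linarith)
    (neg_neg_of_pos (div_pos he0 he'))
  have hθe : (1 - ρ) ^ e * θ ^ (1 - e) = 1 := by
    rw [hθdef, ← Real.rpow_mul hρ'.le, ← Real.rpow_add hρ']
    have : e + -(e / (1 - e)) * (1 - e) = 0 := by field_simp; ring
    rw [this, Real.rpow_zero]
  obtain ⟨M, c, hM, hc, hstep⟩ := h.exists_shift_speed hK hR0 hR hθ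
  refine ⟨M, c, hM, hc, fun δ Q hQ hQ1 hQ2 s hs p => ?_⟩
  have hx := hdrift p.1
  have hy := hdrift p.2
  refine (lintegral_flowCost_le h hV hV0 he0.le he1.le hM hx.1 hy.1 (hQ p)
    (add_nonneg hs hc.le)).trans ?_
  have hi1 : 0 ≤ ∫ y, V y ∂(P p.1) := integral_nonneg hV0
  have hi2 : 0 ≤ ∫ y, V y ∂(P p.2) := integral_nonneg hV0
  have hsub := h.add_le (hV0 p.1) (hV0 p.2)
  have hv0 := add_nonneg (hV0 p.1) (hV0 p.2)
  obtain ⟨hout, hin⟩ := hstep s (V p.1 + V p.2)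
    (M + (∫ y, V y ∂(P p.1) + ∫ y, V y ∂(P p.2))) hs hv0 (by linarith)
    (by linarith [hx.2, hy.2])
  have hδe : (1 + δ) ^ e ≤ 1 + δ := by
    conv_rhs => rw [← ENNReal.rpow_one (1 + δ)]
    exact ENNReal.rpow_le_rpow_of_exponent_le le_self_add he1.le
  have hfl : 0 ≤ flow φ s (M + (V p.1 + V p.2)) :=
    zero_le_one.trans (h.one_le_flow hs (by linarith))
  unfold flowCost
  rcases lt_or_ge R (V p.1 + V p.2) with hRv | hRv
  · calc _ ≤ ((1 + δ) * edist p.1 p.2) ^ e *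
          ENNReal.ofReal (flow φ s (M + (V p.1 + V p.2))) ^ (1 - e) := by
          gcongr
          · exact hQ1 p
          · exact hout hRv
      _ = (1 + δ) ^ e * (edist p.1 p.2 ^ e *
          ENNReal.ofReal (flow φ s (M + (V p.1 + V p.2))) ^ (1 - e)) := by
          rw [ENNReal.mul_rpow_of_nonneg _ _ he0.le, mul_assoc]
      _ ≤ _ := by gcongr
  · have hone : ENNReal.ofReal (1 - ρ) ^ e * ENNReal.ofReal θ ^ (1 - e) = 1 := by
      rw [ENNReal.ofReal_rpow_of_pos hρ', ENNReal.ofReal_rpow_of_pos (by linarith),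
        ← ENNReal.ofReal_mul (by positivity), hθe, ENNReal.ofReal_one]
    calc _ ≤ ((1 + δ) * (ENNReal.ofReal (1 - ρ) * edist p.1 p.2)) ^ e *
          (ENNReal.ofReal θ * ENNReal.ofReal (flow φ s (M + (V p.1 + V p.2)))) ^ (1 - e) := by
          rw [← ENNReal.ofReal_mul (by linarith)]
          gcongr
          · exact hQ2 p hRv
          · exact hin hRv
      _ = (1 + δ) ^ e * ((ENNReal.ofReal (1 - ρ) ^ e * ENNReal.ofReal θ ^ (1 - e)) *
          (edist p.1 p.2 ^ e *
          ENNReal.ofReal (flow φ s (M + (V p.1 + V p.2))) ^ (1 - e))) := by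
          rw [ENNReal.mul_rpow_of_nonneg _ _ he0.le, ENNReal.mul_rpow_of_nonneg _ _ he0.le,
            ENNReal.mul_rpow_of_nonneg _ _ he'.le]
          ring
      _ ≤ _ := by
          rw [hone, one_mul]
          gcongr

end Contraction

/-! ### Iteration of the contraction -/

section Iteration

lemma isCoupling_pow {E : Type*} [MeasurableSpace E] {P : Kernel E E}
    {Q : Kernel (E × E) (E × E)} (hQ : ∀ p, IsCoupling (Q p) (P p.1) (P p.2)) (n : ℕ)
    (p : E × E) : IsCoupling ((Q ^ n) p) ((P ^ n) p.1) ((P ^ n) p.2) := by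
  induction n with
  | zero =>
    simp only [pow_zero]
    change IsCoupling (Kernel.id p) (Kernel.id p.1) (Kernel.id p.2)
    simp only [Kernel.id_apply]
    exact ⟨Measure.map_dirac' measurable_fst p, Measure.map_dirac' measurable_snd p⟩
  | succ n ih =>
    simp only [pow_succ']
    exact ih.bind hQ

lemma isMarkovKernel_pow {E : Type*} [MeasurableSpace E] {P : Kernel E E} [IsMarkovKernel P]
    (n : ℕ) : IsMarkovKernel (P ^ n) := by
  induction n with
  | zero => exact inferInstanceAs (IsMarkovKernel Kernel.id)
  | succ n ih =>
    rw [pow_succ']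
    exact inferInstanceAs (IsMarkovKernel (P ∘ₖ (P ^ n)))

lemma le_of_forall_le_one_add_pow_mul {a b : ℝ≥0∞} (n : ℕ)
    (h : ∀ δ : ℝ≥0∞, δ ≠ 0 → a ≤ (1 + δ) ^ n * b) : a ≤ b := by
  have hlim : Tendsto (fun δ : ℝ≥0∞ => (1 + δ) ^ n * b) (nhdsWithin 0 (Ioi 0)) (nhds b) := by
    have h1 : Tendsto (fun δ : ℝ≥0∞ => (1 + δ) ^ n) (nhds 0) (nhds 1) := by
      have hc : Continuous fun δ : ℝ≥0∞ => (1 + δ) ^ n :=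
        (ENNReal.continuous_pow n).comp (continuous_const_add 1)
      simpa using hc.tendsto 0
    have := ENNReal.Tendsto.mul_const (b := b) h1 (Or.inl one_ne_zero)
    rw [one_mul] at this
    exact this.mono_left nhdsWithin_le_nhds
  refine ge_of_tendsto hlim ?_
  filter_upwards [self_mem_nhdsWithin] with δ hδ using h δ (ne_of_gt hδ)

lemma rpow_le_one_add {t p : ℝ} (ht : 0 ≤ t) (hp0 : 0 ≤ p) (hp1 : p ≤ 1) : t ^ p ≤ 1 + t := by
  rcases le_total t 1 with h | h
  · exact (Real.rpow_le_one ht h hp0).trans (by linarith)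
  · calc t ^ p ≤ t ^ (1 : ℝ) := Real.rpow_le_rpow_of_exponent_le h hp1
      _ ≤ 1 + t := by rw [Real.rpow_one]; linarith

/-- The truncated ratio `min 1 ((a + v) / A)` is controlled by `φ v / φ A`, by concavity; it is
here that `φ ∘ V`, which is integrable for the invariant measure, replaces `V`. -/
lemma IsRate.min_one_rpow_le {φ : ℝ → ℝ} (h : IsRate φ) {A a v p : ℝ} (hA : 1 ≤ A) (ha : 0 ≤ a)
    (hv : 0 ≤ v) (hp0 : 0 ≤ p) (hp1 : p ≤ 1) :
    min 1 (((a + v) / A) ^ p) ≤ (1 + φ 1 * a + φ v) / φ A ^ p := by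
  have hA0 : 0 < A := by linarith
  have hφA : 0 < φ A := h.pos hA0
  have hφ1 : 0 < φ 1 := h.pos one_pos
  have hφv := h.nonneg hv
  have hden : 0 < φ A ^ p := Real.rpow_pos_of_pos hφA p
  have hφa : 0 ≤ φ 1 * a := by positivity
  rcases le_total v A with hvA | hvA
  · refine (min_le_right _ _).trans ?_
    have h1 : (a + v) / A ≤ (φ 1 * a + φ v) / φ A := by
      rw [le_div_iff₀ hφA, add_div, add_mul]
      refine add_le_add ?_ ?_
      · rw [div_mul_eq_mul_div, div_le_iff₀ hA0]
        have := mul_le_mul_of_nonneg_left (h.le_mul hA) ha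
        linarith
      · have := h.smul_le (t := v / A) (by positivity) ((div_le_one hA0).2 hvA) hA0.le
        rwa [div_mul_cancel₀ _ hA0.ne'] at this
    calc ((a + v) / A) ^ p ≤ ((φ 1 * a + φ v) / φ A) ^ p :=
          Real.rpow_le_rpow (by positivity) h1 hp0
      _ = (φ 1 * a + φ v) ^ p / φ A ^ p := Real.div_rpow (by positivity) hφA.le _
      _ ≤ _ := by
          gcongr
          have := rpow_le_one_add (t := φ 1 * a + φ v) (by positivity) hp0 hp1
          linarith
  · refine (min_le_left _ _).trans ?_
    rw [le_div_iff₀ hden, one_mul]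
    have := rpow_le_one_add (t := φ A) hφA.le hp0 hp1
    have := h.mono hA0.le hvA
    linarith

lemma IsRate.measurable_ofReal_comp {E : Type*} [MeasurableSpace E] {φ : ℝ → ℝ} {V : E → ℝ}
    (h : IsRate φ) (hV : Measurable V) (hV0 : ∀ x, 0 ≤ V x) :
    Measurable fun y => ENNReal.ofReal (φ (V y)) := by
  have hmono : Monotone fun t => φ (max 0 t) := fun a b hab =>
    h.mono (le_max_left _ _) (max_le_max le_rfl hab)
  have heq : (fun y => φ (V y)) = (fun t => φ (max 0 t)) ∘ V := by
    funext y
    simp [max_eq_right (hV0 y)]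
  rw [← Function.comp_def ENNReal.ofReal, heq]
  exact ENNReal.measurable_ofReal.comp (hmono.measurable.comp hV)

variable {E : Type*} [MetricSpace E] [MeasurableSpace E] [BorelSpace E]
  [SecondCountableTopology E] {φ : ℝ → ℝ} {V : E → ℝ} {M e : ℝ}

lemma lintegral_flowCost_pow_le (h : IsRate φ) (hV : Measurable V) (hV0 : ∀ x, 0 ≤ V x)
    (hM : 1 < M) {c : ℝ} (hc : 0 ≤ c) {δ : ℝ≥0∞} {Q : Kernel (E × E) (E × E)}
    (hstep : ∀ s, 0 ≤ s → ∀ p,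
      ∫⁻ z, flowCost φ V M e (s + c) z ∂(Q p) ≤ (1 + δ) * flowCost φ V M e s p)
    (n : ℕ) (p : E × E) :
    ∫⁻ z, flowCost φ V M e (c * n) z ∂((Q ^ n) p) ≤ (1 + δ) ^ n * flowCost φ V M e 0 p := by
  have hmeas : ∀ n : ℕ, Measurable (flowCost φ V M e (c * n)) := fun n =>
    measurable_flowCost h hV hV0 hM (by positivity)
  induction n with
  | zero =>
    have h0 := hmeas 0
    simp only [pow_zero, Nat.cast_zero, mul_zero, one_mul] at h0 ⊢
    change ∫⁻ z, flowCost φ V M e 0 z ∂(Kernel.id p) ≤ _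
    rw [Kernel.id_apply, lintegral_dirac' _ h0]
  | succ n ih =>
    rw [pow_succ']
    change ∫⁻ z, _ ∂((Q ∘ₖ (Q ^ n)) p) ≤ _
    rw [Kernel.lintegral_comp _ _ _ (hmeas (n + 1))]
    calc _ ≤ ∫⁻ q, (1 + δ) * flowCost φ V M e (c * n) q ∂((Q ^ n) p) := by
          refine lintegral_mono fun q => ?_
          have := hstep (c * n) (by positivity) q
          rwa [show c * n + c = c * ((n + 1 : ℕ) : ℝ) by push_cast; ring] at this
      _ = (1 + δ) * ∫⁻ q, flowCost φ V M e (c * n) q ∂((Q ^ n) p) :=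
          lintegral_const_mul _ (hmeas n)
      _ ≤ (1 + δ) * ((1 + δ) ^ n * flowCost φ V M e 0 p) := by gcongr
      _ = _ := by ring

/-- The expected distance after `n` steps of the coupled chain. -/
lemma lintegral_edist_pow_le (h : IsRate φ) (hbdd : ∀ x y : E, edist x y ≤ 1)
    (hV : Measurable V) (hV0 : ∀ x, 0 ≤ V x) (he0 : 0 ≤ e) (he1 : e ≤ 1)
    (hM : 1 < M) {c : ℝ} (hc : 0 ≤ c) {δ : ℝ≥0∞} {P : Kernel E E} [IsMarkovKernel P]
    {Q : Kernel (E × E) (E × E)} (hQ : ∀ p, IsCoupling (Q p) (P p.1) (P p.2))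
    (hstep : ∀ s, 0 ≤ s → ∀ p,
      ∫⁻ z, flowCost φ V M e (s + c) z ∂(Q p) ≤ (1 + δ) * flowCost φ V M e s p)
    (n : ℕ) (p : E × E) :
    ∫⁻ z, edist z.1 z.2 ∂((Q ^ n) p) ≤ (1 + δ) ^ n * ENNReal.ofReal
      ((1 + φ 1 * (M + V p.1) + φ (V p.2)) / φ (HInv φ (c * n)) ^ (1 - e)) := by
  have hcn : 0 ≤ c * n := by positivity
  set A := HInv φ (c * n) with hAdef
  have hA : 1 ≤ A := h.one_le_HInv hcn
  have hA0 : 0 < A := by linarith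
  have he' : 0 ≤ 1 - e := by linarith
  have hU : ∀ p : E × E, 1 ≤ M + (V p.1 + V p.2) := fun p => by
    linarith [hV0 p.1, hV0 p.2]
  have hPn := isMarkovKernel_pow (P := P) n
  have := (isCoupling_pow hQ n p).isProbabilityMeasure
  set U := M + (V p.1 + V p.2) with hUdef
  have hU0 : 0 < U := by linarith [hU p]
  have h1 : ∫⁻ z, edist z.1 z.2 ∂((Q ^ n) p) ≤ (1 + δ) ^ n * 1 :=
    calc _ ≤ ∫⁻ _, 1 ∂((Q ^ n) p) := lintegral_mono fun z => hbdd _ _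
      _ = 1 := by simp
      _ ≤ _ := by rw [mul_one]; exact one_le_pow_of_one_le' le_self_add n
  have h2 : ∫⁻ z, edist z.1 z.2 ∂((Q ^ n) p) ≤
      (1 + δ) ^ n * ENNReal.ofReal ((U / A) ^ (1 - e)) := by
    have hA' : ENNReal.ofReal A ^ (1 - e) ≠ 0 := by
      rw [ENNReal.ofReal_rpow_of_pos hA0]
      simpa using Real.rpow_pos_of_pos hA0 _
    have hA'' : ENNReal.ofReal A ^ (1 - e) ≠ ∞ :=
      ENNReal.rpow_ne_top_of_nonneg he' ENNReal.ofReal_ne_top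
    rw [Real.div_rpow hU0.le hA0.le, ENNReal.ofReal_div_of_pos (Real.rpow_pos_of_pos hA0 _),
      ← ENNReal.ofReal_rpow_of_pos hA0, ← ENNReal.ofReal_rpow_of_pos hU0, ← mul_div_assoc,
      ENNReal.le_div_iff_mul_le (Or.inl hA') (Or.inl hA''),
      ← lintegral_mul_const _ (by fun_prop)]
    calc _ ≤ ∫⁻ z, flowCost φ V M e (c * n) z ∂((Q ^ n) p) := by
          refine lintegral_mono fun z => ?_
          unfold flowCost
          gcongr
          · conv_lhs => rw [← ENNReal.rpow_one (edist z.1 z.2)]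
            exact ENNReal.rpow_le_rpow_of_exponent_ge (hbdd _ _) he1
          · exact h.HInv_le_flow hcn (hU z)
      _ ≤ (1 + δ) ^ n * flowCost φ V M e 0 p :=
          lintegral_flowCost_pow_le h hV hV0 hM hc hstep n p
      _ ≤ _ := by
          unfold flowCost
          rw [h.flow_zero (hU p)]
          gcongr
          refine mul_le_of_le_one_left' ?_
          exact ENNReal.rpow_le_one (hbdd _ _) he0
  calc _ ≤ (1 + δ) ^ n * min 1 (ENNReal.ofReal ((U / A) ^ (1 - e))) := by
        rcases min_choice 1 (ENNReal.ofReal ((U / A) ^ (1 - e))) with hmin | hmin <;> rw [hmin]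
        exacts [h1, h2]
    _ ≤ _ := by
        gcongr
        have := h.min_one_rpow_le (a := M + V p.1) (v := V p.2) hA
          (by linarith [hV0 p.1]) (hV0 p.2) he' (by linarith : 1 - e ≤ 1)
        rw [← ENNReal.ofReal_one, ← ENNReal.ofReal_min]
        refine ENNReal.ofReal_le_ofReal ?_
        rwa [hUdef, ← add_assoc]

/-- The chain forgets its starting point: quantitative bound on the distance between the laws
after `n` steps of the chain started at `x` and of the chain with initial law `ν`. -/
theorem exists_W_pow_bind_le [Nonempty E] (h : IsRate φ) {P : Kernel E E} [IsMarkovKernel P]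
    (hbdd : ∀ x y : E, edist x y ≤ 1) (hV : Measurable V) (hV0 : ∀ x, 0 ≤ V x)
    {K R ρ : ℝ} (hK : 0 ≤ K)
    (hdrift : ∀ x, Integrable V (P x) ∧ ∫ y, V y ∂(P x) ≤ V x - φ (V x) + K)
    (hR0 : 0 ≤ R) (hR : 2 * K < φ R) (hρ0 : 0 < ρ) (hρ1 : ρ < 1)
    (hcontr : ∀ x y, W dist (P x) (P y) ≤ edist x y)
    (hsmall : ∀ x y, V x + V y ≤ R → W dist (P x) (P y) ≤ ENNReal.ofReal (1 - ρ) * edist x y)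
    (he0 : 0 < e) (he1 : e < 1) :
    ∃ M c : ℝ, 1 < M ∧ 0 < c ∧ ∀ (x : E) (n : ℕ) (ν : Measure E), IsProbabilityMeasure ν →
      W dist ((P ^ n) x) (ν.bind ⇑(P ^ n)) ≤
        (ENNReal.ofReal (1 + φ 1 * (M + V x)) + ∫⁻ y, ENNReal.ofReal (φ (V y)) ∂ν) /
          ENNReal.ofReal (φ (HInv φ (c * n)) ^ (1 - e)) := by
  obtain ⟨M, c, hM, hc, hstep⟩ := exists_flowCost_step (e := e) h hV hV0 hK hdrift hR0 hR hρ0 hρ1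
    he0 he1
  refine ⟨M, c, hM, hc, fun x n ν hν => le_of_forall_le_one_add_pow_mul n fun δ hδ => ?_⟩
  obtain ⟨Q, hQ, hQ1, hQ2⟩ := exists_coupling_kernel hbdd hV hρ0.le hρ1 hcontr hsmall hδ
  have hB : 0 < φ (HInv φ (c * n)) ^ (1 - e) := Real.rpow_pos_of_pos
    (h.pos (zero_lt_one.trans_le (h.one_le_HInv (by positivity)))) _
  have hφ1 := h.pos one_pos
  have hΓ : IsCoupling ((Measure.dirac x).prod ν) (Measure.dirac x) ν := isCoupling_prod
  have hΓn := hΓ.bind (isCoupling_pow hQ n)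
  rw [Measure.dirac_bind (P ^ n).measurable] at hΓn
  refine hΓn.W_le.trans ?_
  have hVφ := h.measurable_ofReal_comp hV hV0
  have hm : Measurable fun y =>
      ENNReal.ofReal (1 + φ 1 * (M + V x)) + ENNReal.ofReal (φ (V y)) := measurable_const.add hVφ
  rw [Measure.lintegral_bind (Q ^ n).measurable.aemeasurable (by fun_prop),
    Measure.dirac_prod, lintegral_map (Measurable.lintegral_kernel (by fun_prop)) (by fun_prop)]
  calc _ ≤ ∫⁻ y, (1 + δ) ^ n * ENNReal.ofReal
        ((1 + φ 1 * (M + V x) + φ (V y)) / φ (HInv φ (c * n)) ^ (1 - e)) ∂ν :=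
        lintegral_mono fun y => lintegral_edist_pow_le h hbdd hV hV0 he0.le he1.le hM hc.le hQ
          (hstep δ Q hQ hQ1 hQ2) n (x, y)
    _ = (1 + δ) ^ n * ∫⁻ y, (ENNReal.ofReal (1 + φ 1 * (M + V x)) + ENNReal.ofReal (φ (V y))) *
          (ENNReal.ofReal (φ (HInv φ (c * n)) ^ (1 - e)))⁻¹ ∂ν := by
        rw [← lintegral_const_mul _ (hm.mul_const _)]
        refine lintegral_congr fun y => ?_
        rw [ENNReal.ofReal_div_of_pos hB, div_eq_mul_inv (ENNReal.ofReal _), ENNReal.ofReal_add]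
        · have := hV0 x
          positivity
        · exact h.nonneg (hV0 y)
    _ = _ := by
        rw [lintegral_mul_const _ hm, lintegral_add_left measurable_const,
          lintegral_const, measure_univ, mul_one, ← div_eq_mul_inv]

end Iteration

/-! ### Lyapunov estimates -/

section Lyapunov

variable {E : Type*} [MeasurableSpace E] {φ : ℝ → ℝ} {V : E → ℝ} {P : Kernel E E} {K : ℝ}

lemma lintegral_pow_succ {f : E → ℝ≥0∞} (hf : Measurable f) (n : ℕ) (x : E) :
    ∫⁻ y, f y ∂((P ^ (n + 1)) x) = ∫⁻ z, ∫⁻ y, f y ∂(P z) ∂((P ^ n) x) := by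
  rw [pow_succ']
  change ∫⁻ y, f y ∂((P ∘ₖ (P ^ n)) x) = _
  rw [Kernel.lintegral_comp _ _ _ hf]

lemma lintegral_drift (h : IsRate φ) (hV0 : ∀ x, 0 ≤ V x) (hK : 0 ≤ K)
    (hdrift : ∀ x, Integrable V (P x) ∧ ∫ y, V y ∂(P x) ≤ V x - φ (V x) + K) (x : E) :
    ENNReal.ofReal (φ (V x)) + ∫⁻ y, ENNReal.ofReal (V y) ∂(P x) ≤
      ENNReal.ofReal (V x) + ENNReal.ofReal K := by
  rw [← ofReal_integral_eq_lintegral_ofReal (hdrift x).1 (Eventually.of_forall hV0),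
    ← ENNReal.ofReal_add (h.nonneg (hV0 x)) (integral_nonneg hV0),
    ← ENNReal.ofReal_add (hV0 x) hK]
  exact ENNReal.ofReal_le_ofReal (by linarith [(hdrift x).2])

lemma bind_pow_eq_of_invariant {π : Measure E} (hπ : Kernel.Invariant P π) (n : ℕ) :
    π.bind ⇑(P ^ n) = π := by
  induction n with
  | zero => exact Measure.id_comp
  | succ n ih =>
    rw [pow_succ']
    exact Kernel.Invariant.comp (κ := P) (η := P ^ n) hπ ih

variable [IsMarkovKernel P]

/-- The drift condition summed over the first `N` steps of the chain. -/
lemma sum_lintegral_le (h : IsRate φ) (hV : Measurable V) (hV0 : ∀ x, 0 ≤ V x) (hK : 0 ≤ K)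
    (hdrift : ∀ x, Integrable V (P x) ∧ ∫ y, V y ∂(P x) ≤ V x - φ (V x) + K) (x : E) (N : ℕ) :
    ∑ m ∈ Finset.range N, ∫⁻ y, ENNReal.ofReal (φ (V y)) ∂((P ^ m) x) +
      ∫⁻ y, ENNReal.ofReal (V y) ∂((P ^ N) x) ≤ ENNReal.ofReal (V x) + N * ENNReal.ofReal K := by
  have hφV := h.measurable_ofReal_comp hV hV0
  have hV' : Measurable fun y => ENNReal.ofReal (V y) := by fun_prop
  induction N with
  | zero =>
    simp only [pow_zero, Finset.range_zero, Finset.sum_empty, zero_add, Nat.cast_zero, zero_mul,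
      add_zero]
    change ∫⁻ y, ENNReal.ofReal (V y) ∂(Kernel.id x) ≤ _
    rw [Kernel.id_apply, lintegral_dirac' _ hV']
  | succ N ih =>
    have := isMarkovKernel_pow (P := P) N
    have hstep : ∫⁻ y, ENNReal.ofReal (φ (V y)) ∂((P ^ N) x) +
        ∫⁻ y, ENNReal.ofReal (V y) ∂((P ^ (N + 1)) x) ≤
        ∫⁻ y, ENNReal.ofReal (V y) ∂((P ^ N) x) + ENNReal.ofReal K := by
      rw [lintegral_pow_succ hV', ← lintegral_add_left hφV]
      calc _ ≤ ∫⁻ z, (ENNReal.ofReal (V z) + ENNReal.ofReal K) ∂((P ^ N) x) :=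
            lintegral_mono fun z => lintegral_drift h hV0 hK hdrift z
        _ = _ := by rw [lintegral_add_left hV']; simp
    rw [Finset.sum_range_succ, add_assoc]
    calc _ ≤ ∑ m ∈ Finset.range N, ∫⁻ y, ENNReal.ofReal (φ (V y)) ∂((P ^ m) x) +
          (∫⁻ y, ENNReal.ofReal (V y) ∂((P ^ N) x) + ENNReal.ofReal K) := by gcongr
      _ ≤ ENNReal.ofReal (V x) + N * ENNReal.ofReal K + ENNReal.ofReal K := by
          rw [← add_assoc]; gcongr
      _ = _ := by push_cast; ring

/-- For an invariant law the drift condition bounds the integral of `φ ∘ V`. As `V` itself need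
not be integrable, the summed drift inequality is used for a truncation of `φ ∘ V`. -/
lemma lintegral_le_of_invariant (h : IsRate φ) (hV : Measurable V) (hV0 : ∀ x, 0 ≤ V x)
    (hK : 0 ≤ K) (hdrift : ∀ x, Integrable V (P x) ∧ ∫ y, V y ∂(P x) ≤ V x - φ (V x) + K)
    {π : Measure E} [IsProbabilityMeasure π] (hπ : Kernel.Invariant P π) :
    ∫⁻ x, ENNReal.ofReal (φ (V x)) ∂π ≤ ENNReal.ofReal K := by
  have hφV := h.measurable_ofReal_comp hV hV0
  have hV' : Measurable fun y => ENNReal.ofReal (V y) := by fun_prop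
  have htrunc : ∀ L : ℕ, ∫⁻ x, min (ENNReal.ofReal (φ (V x))) L ∂π ≤ ENNReal.ofReal K := by
    intro L
    have hψ : Measurable fun x => min (ENNReal.ofReal (φ (V x))) (L : ℝ≥0∞) :=
      hφV.min measurable_const
    have hinv : ∀ m : ℕ, ∫⁻ x, ∫⁻ y, min (ENNReal.ofReal (φ (V y))) L ∂((P ^ m) x) ∂π =
        ∫⁻ x, min (ENNReal.ofReal (φ (V x))) L ∂π := by
      intro m
      rw [← Measure.lintegral_bind (P ^ m).measurable.aemeasurable hψ.aemeasurable,
        bind_pow_eq_of_invariant hπ]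
    have hbound : ∀ N : ℕ, ∫⁻ x, min (ENNReal.ofReal (φ (V x))) L ∂π ≤
        ∫⁻ x, min (L : ℝ≥0∞) (ENNReal.ofReal (V x) / (N + 1 : ℕ) + ENNReal.ofReal K) ∂π := by
      intro N
      have hN0 : ((N + 1 : ℕ) : ℝ≥0∞) ≠ 0 := by simp
      have hNt : ((N + 1 : ℕ) : ℝ≥0∞) ≠ ∞ := ENNReal.natCast_ne_top _
      have hsum : ((N + 1 : ℕ) : ℝ≥0∞) * ∫⁻ x, min (ENNReal.ofReal (φ (V x))) L ∂π =
          ∫⁻ x, ∑ m ∈ Finset.range (N + 1),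
            ∫⁻ y, min (ENNReal.ofReal (φ (V y))) L ∂((P ^ m) x) ∂π := by
        rw [lintegral_finsetSum _ fun m _ => hψ.lintegral_kernel]
        simp [hinv]
      rw [← ENNReal.mul_le_mul_iff_right hN0 hNt, hsum,
        ← lintegral_const_mul _ (measurable_const.min ((hV'.div_const _).add_const _))]
      refine lintegral_mono fun x => ?_
      have hpow := fun m => isMarkovKernel_pow (P := P) m
      have h1 : ∑ m ∈ Finset.range (N + 1), ∫⁻ y, min (ENNReal.ofReal (φ (V y))) L ∂((P ^ m) x) ≤
          ((N + 1 : ℕ) : ℝ≥0∞) * L := by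
        calc _ ≤ ∑ m ∈ Finset.range (N + 1), (L : ℝ≥0∞) := by
              refine Finset.sum_le_sum fun m _ => ?_
              calc _ ≤ ∫⁻ _, (L : ℝ≥0∞) ∂((P ^ m) x) := lintegral_mono fun y => min_le_right _ _
                _ = L := by simp
          _ = _ := by simp
      have h2 : ∑ m ∈ Finset.range (N + 1), ∫⁻ y, min (ENNReal.ofReal (φ (V y))) L ∂((P ^ m) x) ≤
          ((N + 1 : ℕ) : ℝ≥0∞) *
            (ENNReal.ofReal (V x) / (N + 1 : ℕ) + ENNReal.ofReal K) := by
        rw [mul_add, ENNReal.mul_div_cancel hN0 hNt]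
        refine le_trans ?_ (le_self_add.trans
          (sum_lintegral_le h hV hV0 hK hdrift x (N + 1)))
        exact Finset.sum_le_sum fun m _ => lintegral_mono fun y => min_le_left _ _
      rcases min_choice (L : ℝ≥0∞) (ENNReal.ofReal (V x) / (N + 1 : ℕ) + ENNReal.ofReal K)
        with hmin | hmin <;> simp only [hmin]
      exacts [h1, h2]
    have hlim : Tendsto (fun N : ℕ => ∫⁻ x, min (L : ℝ≥0∞)
        (ENNReal.ofReal (V x) / (N + 1 : ℕ) + ENNReal.ofReal K) ∂π) atTop
        (nhds (∫⁻ _, min (L : ℝ≥0∞) (ENNReal.ofReal K) ∂π)) := by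
      refine tendsto_lintegral_of_dominated_convergence (fun _ => (L : ℝ≥0∞))
        (fun N => measurable_const.min ((hV'.div_const _).add_const _))
        (fun N => Eventually.of_forall fun x => min_le_left _ _) (by simp) ?_
      refine Eventually.of_forall fun x => Tendsto.min tendsto_const_nhds ?_
      have h1 : Tendsto (fun N : ℕ => ENNReal.ofReal (V x) / ((N + 1 : ℕ) : ℝ≥0∞)) atTop
          (nhds 0) :=
        (ENNReal.Tendsto.const_div ENNReal.tendsto_nat_nhds_top
          (Or.inr ENNReal.ofReal_ne_top)).comp (tendsto_add_atTop_nat 1) |>.trans (by simp)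
      simpa using h1.add (tendsto_const_nhds (x := ENNReal.ofReal K))
    refine (ge_of_tendsto' hlim hbound).trans ?_
    simp
  have hsup : ∀ x, ⨆ L : ℕ, min (ENNReal.ofReal (φ (V x))) (L : ℝ≥0∞) =
      ENNReal.ofReal (φ (V x)) := by
    intro x
    have := (inf_iSup_eq (ENNReal.ofReal (φ (V x))) (fun L : ℕ => (L : ℝ≥0∞))).symm
    rwa [ENNReal.iSup_natCast, inf_top_eq] at this
  calc ∫⁻ x, ENNReal.ofReal (φ (V x)) ∂π
      = ∫⁻ x, ⨆ L : ℕ, min (ENNReal.ofReal (φ (V x))) (L : ℝ≥0∞) ∂π := by simp_rw [hsup]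
    _ = ⨆ L : ℕ, ∫⁻ x, min (ENNReal.ofReal (φ (V x))) (L : ℝ≥0∞) ∂π :=
        lintegral_iSup (fun L => hφV.min measurable_const)
          fun a b hab x => min_le_min le_rfl (by exact_mod_cast hab)
    _ ≤ _ := iSup_le htrunc

/-- For every lag `j` there are two times at distance `j` at which `φ ∘ V` has expectation at most
`2 K + 1`: on average over the times, both expectations are at most about `K`. -/
lemma exists_lintegral_add_le (h : IsRate φ) (hV : Measurable V) (hV0 : ∀ x, 0 ≤ V x)
    (hK : 0 ≤ K) (hdrift : ∀ x, Integrable V (P x) ∧ ∫ y, V y ∂(P x) ≤ V x - φ (V x) + K)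
    (x : E) (j : ℕ) :
    ∃ m : ℕ, ∫⁻ y, ENNReal.ofReal (φ (V y)) ∂((P ^ m) x) +
      ∫⁻ y, ENNReal.ofReal (φ (V y)) ∂((P ^ (m + j)) x) ≤ ENNReal.ofReal (2 * K + 1) := by
  set a : ℕ → ℝ≥0∞ := fun m => ∫⁻ y, ENNReal.ofReal (φ (V y)) ∂((P ^ m) x) with ha
  by_contra! hcon
  have hsum : ∀ N : ℕ, ∑ m ∈ Finset.range N, a m ≤ ENNReal.ofReal (V x + N * K) := fun N => by
    rw [ENNReal.ofReal_add (hV0 x) (by positivity), ENNReal.ofReal_mul (by positivity),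
      ENNReal.ofReal_natCast]
    exact le_self_add.trans (sum_lintegral_le h hV hV0 hK hdrift x N)
  have hshift : ∀ N : ℕ, ∑ m ∈ Finset.range N, a (m + j) ≤ ENNReal.ofReal (V x + (N + j) * K) := by
    intro N
    have h1 := hsum (j + N)
    rw [Finset.sum_range_add] at h1
    refine (le_trans ?_ h1).trans (le_of_eq (by push_cast; ring_nf))
    refine le_trans (le_of_eq ?_) le_add_self
    exact Finset.sum_congr rfl fun m _ => by rw [add_comm]
  obtain ⟨N, hN⟩ := exists_nat_gt (2 * V x + j * K)
  have h1 : (N : ℝ≥0∞) * ENNReal.ofReal (2 * K + 1) ≤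
      ENNReal.ofReal (V x + N * K) + ENNReal.ofReal (V x + (N + j) * K) := by
    calc _ = ∑ m ∈ Finset.range N, ENNReal.ofReal (2 * K + 1) := by simp
      _ ≤ ∑ m ∈ Finset.range N, (a m + a (m + j)) := Finset.sum_le_sum fun m _ => (hcon m).le
      _ ≤ _ := by
        rw [Finset.sum_add_distrib]
        exact add_le_add (hsum N) (hshift N)
  have hVx := hV0 x
  rw [← ENNReal.ofReal_natCast, ← ENNReal.ofReal_mul (by positivity),
    ← ENNReal.ofReal_add (by positivity) (by positivity),
    ENNReal.ofReal_le_ofReal_iff (by positivity)] at h1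
  linarith

end Lyapunov

/-! ### The invariant measure -/

section Invariant

variable {E : Type*} [MetricSpace E] [MeasurableSpace E] [BorelSpace E]
  [SecondCountableTopology E] {φ : ℝ → ℝ} {V : E → ℝ} {P : Kernel E E} [IsMarkovKernel P]

/-- A kernel that contracts the distance between Dirac masses contracts it for all laws. -/
lemma W_bind_le [Nonempty E] (hbdd : ∀ x y : E, edist x y ≤ 1)
    (hcontr : ∀ x y, W dist (P x) (P y) ≤ edist x y) (μ ν : Measure E) :
    W dist (μ.bind P) (ν.bind P) ≤ W dist μ ν := by
  rw [W_dist_eq (μ := μ)]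
  refine le_iInf₂ fun γ hγ => le_of_forall_le_one_add_pow_mul 1 fun δ hδ => ?_
  obtain ⟨Q, hQ, hQ1, -⟩ := exists_coupling_kernel (V := fun _ : E => (0 : ℝ)) (R := -1) (ρ := 0)
    hbdd measurable_const le_rfl one_pos hcontr (fun x y h => by norm_num at h) hδ
  refine (hγ.bind hQ).W_le.trans ?_
  rw [Measure.lintegral_bind Q.measurable.aemeasurable (by fun_prop), pow_one,
    ← lintegral_const_mul _ (by fun_prop)]
  exact lintegral_mono hQ1

lemma tendsto_const_div_rate (h : IsRate φ) {c p : ℝ} (hc : 0 < c) (hp : 0 < p) {C : ℝ≥0∞}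
    (hC : C ≠ ∞) :
    Tendsto (fun n : ℕ => C / ENNReal.ofReal (φ (HInv φ (c * n)) ^ p)) atTop (nhds 0) := by
  have h1 : Tendsto (fun n : ℕ => φ (HInv φ (c * n)) ^ p) atTop atTop :=
    (tendsto_rpow_atTop hp).comp (h.tendsto_top.comp (h.tendsto_HInv.comp
      (tendsto_natCast_atTop_atTop.const_mul_atTop hc)))
  have h2 := ENNReal.Tendsto.const_div (a := C) (ENNReal.tendsto_ofReal_atTop.comp h1)
    (Or.inr hC)
  simpa using h2

lemma W_eq_zero_of_tendsto [CompleteSpace E] [Nonempty E] {μ : ℕ → Measure E} {π π' : Measure E}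
    [∀ n, IsProbabilityMeasure (μ n)] {a : ℕ → ℝ≥0∞} (ha : Tendsto a atTop (nhds 0))
    (h1 : Tendsto (fun n => W dist (μ n) π) atTop (nhds 0)) (h2 : ∀ n, W dist (μ n) π' ≤ a n) :
    W dist π' π = 0 := by
  have hlim : Tendsto (fun n => a n + W dist (μ n) π) atTop (nhds 0) := by
    simpa using ha.add h1
  refine le_antisymm (ge_of_tendsto' hlim fun n => W_triangle.trans (add_le_add_left ?_ _)) zero_le
  rw [W_comm]
  exact h2 n

/-- If the chain forgets its starting point at a rate governed by the integral of `φ ∘ V`, then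
the laws of the chain converge to an invariant law. -/
theorem exists_invariant [CompleteSpace E] [Nonempty E] (h : IsRate φ)
    (hbdd : ∀ x y : E, edist x y ≤ 1) (hV : Measurable V) (hV0 : ∀ x, 0 ≤ V x)
    {K : ℝ} (hK : 0 ≤ K)
    (hdrift : ∀ x, Integrable V (P x) ∧ ∫ y, V y ∂(P x) ≤ V x - φ (V x) + K)
    (hcontr : ∀ x y, W dist (P x) (P y) ≤ edist x y)
    {M c p : ℝ} (hc : 0 < c) (hp : 0 < p)
    (hW : ∀ (x : E) (n : ℕ) (ν : Measure E), IsProbabilityMeasure ν →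
      W dist ((P ^ n) x) (ν.bind ⇑(P ^ n)) ≤
        (ENNReal.ofReal (1 + φ 1 * (M + V x)) + ∫⁻ y, ENNReal.ofReal (φ (V y)) ∂ν) /
          ENNReal.ofReal (φ (HInv φ (c * n)) ^ p)) (x : E) :
    ∃ π : Measure E, IsProbabilityMeasure π ∧ Kernel.Invariant P π ∧
      Tendsto (fun n => W dist ((P ^ n) x) π) atTop (nhds 0) := by
  have hpow := fun n => isMarkovKernel_pow (P := P) n
  set D : ℕ → ℝ≥0∞ := fun n => (ENNReal.ofReal (1 + φ 1 * (M + V x)) + ENNReal.ofReal (2 * K + 1)) /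
    ENNReal.ofReal (φ (HInv φ (c * n)) ^ p) with hD
  have hDlim : Tendsto D atTop (nhds 0) :=
    tendsto_const_div_rate h hc hp (ENNReal.add_ne_top.2 ⟨ENNReal.ofReal_ne_top,
      ENNReal.ofReal_ne_top⟩)
  have hstep : ∀ n k : ℕ, ∫⁻ y, ENNReal.ofReal (φ (V y)) ∂((P ^ k) x) ≤ ENNReal.ofReal (2 * K + 1) →
      W dist ((P ^ n) x) ((P ^ (n + k)) x) ≤ D n := by
    intro n k hk
    refine le_trans (le_of_eq ?_) ((hW x n ((P ^ k) x) inferInstance).trans ?_)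
    · rw [pow_add]
      rfl
    · exact ENNReal.div_le_div_right (add_le_add_right hk _) _
  have hpair : ∀ n j : ℕ, W dist ((P ^ n) x) ((P ^ (n + j)) x) ≤ D n + D (n + j) := by
    intro n j
    obtain ⟨m, hm⟩ := exists_lintegral_add_le h hV hV0 hK hdrift x j
    refine (W_triangle (ν := (P ^ (n + (m + j))) x)).trans (add_le_add ?_ ?_)
    · exact hstep n (m + j) (le_add_self.trans hm)
    · rw [W_comm, show n + (m + j) = n + j + m by ring]
      exact hstep (n + j) m (le_self_add.trans hm)
  have hle : ∀ n k : ℕ, W dist ((P ^ n) x) ((P ^ k) x) ≤ D n + D k := by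
    intro n k
    rcases le_total n k with hnk | hnk
    · obtain ⟨j, rfl⟩ := Nat.exists_eq_add_of_le hnk
      exact hpair n j
    · obtain ⟨j, rfl⟩ := Nat.exists_eq_add_of_le hnk
      rw [W_comm, add_comm (D (k + j))]
      exact hpair k j
  obtain ⟨π, hπ, hlim⟩ := exists_tendsto_W (μ := fun n => (P ^ n) x) (by
    intro ε hε
    obtain ⟨N, hN⟩ := eventually_atTop.1 (hDlim.eventually_lt_const (ENNReal.half_pos hε.ne'))
    refine ⟨N, fun m hm n hn => (hle m n).trans_lt ?_⟩
    rw [← ENNReal.add_halves ε]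
    exact ENNReal.add_lt_add (hN m hm) (hN n hn))
  refine ⟨π, hπ, ?_, hlim⟩
  refine eq_of_W_eq_zero (W_eq_zero_of_tendsto (μ := fun n => (P ^ (n + 1)) x)
    (a := fun n => W dist ((P ^ n) x) π) hlim (hlim.comp (tendsto_add_atTop_nat 1)) fun n => ?_)
  have heq : (P ^ (n + 1)) x = ((P ^ n) x).bind P := by
    rw [pow_succ']
    rfl
  rw [heq]
  exact W_bind_le hbdd hcontr _ _

end Invariant

end SubgeomErgodic

theorem theorem2p1 {E : Type*} [MetricSpace E] [CompleteSpace E]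
    [TopologicalSpace.SeparableSpace E] [MeasurableSpace E] [BorelSpace E] [Nonempty E]
    -- the transition kernel of the Markov chain; `(P ^ n) x` is the law of `X_n` under `P_x`
    (P : Kernel E E) [IsMarkovKernel P]
    (V : E → ℝ) (hV : Measurable V) (hV0 : ∀ x, 0 ≤ V x)
    (φ : ℝ → ℝ) (hφ0 : φ 0 = 0) (hφconc : ConcaveOn ℝ (Ici 0) φ)
    (hφcont : ContinuousOn φ (Ici 0)) (hφdiff : DifferentiableOn ℝ φ (Ioi 0))
    (hφmono : StrictMonoOn φ (Ici 0)) (hφtop : Tendsto φ atTop atTop)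
    (K : ℝ) (hK : 0 ≤ K)
    -- `PV ≤ V - φ ∘ V + K`
    (hLyap : ∀ x, Integrable V (P x) ∧ ∫ y, V y ∂(P x) ≤ V x - φ (V x) + K)
    -- the metric is contracting and bounded by `1`
    (hcontr : ∀ x y, SubgeomErgodic.W dist (P x) (P y) ≤ ENNReal.ofReal (dist x y))
    (hbdd : ∀ x y : E, dist x y ≤ 1)
    -- `r = φ⁻¹(2K)` and `R > r`
    (r R : ℝ) (hr0 : 0 ≤ r) (hr : φ r = 2 * K) (hR : r < R)
    (hsmall : SubgeomErgodic.IsDSmall dist P {p : E × E | V p.1 + V p.2 ≤ R}) :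
    ∃ π : Measure E,
      (IsProbabilityMeasure π ∧ Kernel.Invariant P π) ∧
      (∀ π' : Measure E, IsProbabilityMeasure π' → Kernel.Invariant P π' → π' = π) ∧
      (Integrable (fun u => φ (V u)) π ∧ ∫ u, φ (V u) ∂π ≤ K) ∧
      ∀ ε : ℝ, 0 < ε → ∃ C₁ C₂ : ℝ, 0 < C₁ ∧ 0 < C₂ ∧ ∀ (x : E) (n : ℕ),
        SubgeomErgodic.W dist ((P ^ n) x) π ≤
          ENNReal.ofReal
            (C₁ * (1 + V x) / φ (SubgeomErgodic.HInv φ (C₂ * n)) ^ (1 - ε)) := by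
  open SubgeomErgodic in
  have : SecondCountableTopology E := UniformSpace.secondCountable_of_separable E
  have h : IsRate φ := ⟨hφ0, hφconc, hφcont, hφdiff, hφmono, hφtop⟩
  have hbdd' : ∀ x y : E, edist x y ≤ 1 := fun x y => by
    rw [edist_dist]
    exact ENNReal.ofReal_le_one.2 (hbdd x y)
  have hcontr' : ∀ x y, W dist (P x) (P y) ≤ edist x y := fun x y => by
    rw [edist_dist]
    exact hcontr x y
  have hR0 : 0 ≤ R := hr0.trans hR.le
  have hφR : 2 * K < φ R := hr ▸ hφmono hr0 hR0 hR
  have hpow := fun n => isMarkovKernel_pow (P := P) n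
  obtain ⟨ρ, hρ0, hρ⟩ := hsmall
  -- the contraction constant may be taken smaller than `1`
  have hρ' : ∀ x y, V x + V y ≤ R →
      W dist (P x) (P y) ≤ ENNReal.ofReal (1 - min ρ 2⁻¹) * edist x y := by
    intro x y hxy
    refine (hρ (x, y) hxy).trans ?_
    rw [edist_dist, ← ENNReal.ofReal_mul (by linarith [min_le_right ρ (2⁻¹ : ℝ)])]
    exact ENNReal.ofReal_le_ofReal (mul_le_mul_of_nonneg_right
      (by linarith [min_le_left ρ (2⁻¹ : ℝ)]) dist_nonneg)
  have hbound : ∀ e : ℝ, 0 < e → e < 1 → _ := fun e he0 he1 =>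
    exists_W_pow_bind_le (e := e) h hbdd' hV hV0 hK hLyap hR0 hφR (lt_min hρ0 (by norm_num))
      (lt_of_le_of_lt (min_le_right ρ (2⁻¹ : ℝ)) (by norm_num)) hcontr' hρ' he0 he1
  have hφV := h.measurable_ofReal_comp hV hV0
  obtain ⟨x₀⟩ := ‹Nonempty E›
  obtain ⟨M₀, c₀, hM₀, hc₀, hW₀⟩ := hbound 2⁻¹ (by norm_num) (by norm_num)
  obtain ⟨π, hπ, hinv, hlim⟩ := exists_invariant h hbdd' hV hV0 hK hLyap hcontr' hc₀
    (by norm_num) hW₀ x₀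
  have hlint := lintegral_le_of_invariant h hV hV0 hK hLyap hinv
  have hφV0 : ∀ u, 0 ≤ φ (V u) := fun u => h.nonneg (hV0 u)
  have hφVm : Measurable fun u => φ (V u) := by
    have := hφV.ennreal_toReal
    simpa only [ENNReal.toReal_ofReal (hφV0 _)] using this
  refine ⟨π, ⟨hπ, hinv⟩, fun π' hπ' hinv' => ?_, ⟨?_, ?_⟩, fun ε hε => ?_⟩
  · refine eq_of_W_eq_zero (W_eq_zero_of_tendsto (μ := fun n => (P ^ n) x₀)
      (tendsto_const_div_rate h hc₀ (p := 1 - 2⁻¹) (by norm_num)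
        (C := ENNReal.ofReal (1 + φ 1 * (M₀ + V x₀)) + ENNReal.ofReal K)
        (ENNReal.add_ne_top.2 ⟨ENNReal.ofReal_ne_top, ENNReal.ofReal_ne_top⟩)) hlim fun n => ?_)
    have h1 := hW₀ x₀ n π' hπ'
    rw [bind_pow_eq_of_invariant hinv'] at h1
    exact h1.trans (ENNReal.div_le_div_right (add_le_add_right
      (lintegral_le_of_invariant h hV hV0 hK hLyap hinv') _) _)
  · refine ⟨hφVm.aestronglyMeasurable, ?_⟩
    rw [hasFiniteIntegral_iff_ofReal (Eventually.of_forall hφV0)]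
    exact hlint.trans_lt ENNReal.ofReal_lt_top
  · rw [integral_eq_lintegral_of_nonneg_ae (Eventually.of_forall hφV0)
      hφVm.aestronglyMeasurable]
    exact ENNReal.toReal_le_of_le_ofReal hK hlint
  have hφ1 : 0 < φ 1 := h.pos one_pos
  rcases lt_or_ge ε 1 with hε1 | hε1
  · obtain ⟨M, c, hM, hc, hW⟩ := hbound ε hε hε1
    refine ⟨1 + φ 1 * M + φ 1 + K, c, by positivity, hc, fun x n => ?_⟩
    have hB : 0 < φ (HInv φ (c * n)) ^ (1 - ε) := Real.rpow_pos_of_pos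
      (h.pos (zero_lt_one.trans_le (h.one_le_HInv (by positivity)))) _
    have h1 := hW x n π hπ
    rw [bind_pow_eq_of_invariant hinv] at h1
    have hVx := hV0 x
    refine h1.trans ?_
    rw [ENNReal.ofReal_div_of_pos hB]
    refine ENNReal.div_le_div_right ((add_le_add_right hlint _).trans ?_) _
    rw [← ENNReal.ofReal_add (by positivity) hK]
    refine ENNReal.ofReal_le_ofReal ?_
    have : 0 ≤ (1 + φ 1 * M + K) * V x := by positivity
    linarith
  · -- here the exponent `1 - ε` is not positive, so the bound does not tend to zero
    refine ⟨φ 1 ^ (1 - ε), 1, by positivity, one_pos, fun x n => (W_le_one hbdd).trans ?_⟩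
    have hA : φ 1 ≤ φ (HInv φ (1 * n)) :=
      h.mono zero_le_one (h.one_le_HInv (by positivity))
    have hB : 0 < φ (HInv φ (1 * n)) ^ (1 - ε) := Real.rpow_pos_of_pos (hφ1.trans_le hA) _
    rw [ENNReal.one_le_ofReal, one_le_div hB]
    calc φ (HInv φ (1 * n)) ^ (1 - ε) ≤ φ 1 ^ (1 - ε) :=
          Real.rpow_le_rpow_of_nonpos hφ1 hA (by linarith)
      _ ≤ φ 1 ^ (1 - ε) * (1 + V x) :=
          le_mul_of_one_le_right (by positivity) (by linarith [hV0 x])
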